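/- For an odd prime $p$ let $W_p = (2^p+1)/3$ denote the $p$-th Wagstaff number (a positive integer). The Wagstaff number $$W_{12391} = \frac{2^{12391}+1}{3}$$ is prime, and it has exactly $3730$ decimal digits. -/

import Mathlib

/-- The Wagstaff number `W_p = (2 ^ p + 1) / 3`. For odd `p` the division is exact, see
`three_mul_wagstaff`. -/
def wagstaff (p : ℕ) : ℕ := (2 ^ p + 1) / 3

/-- For odd `p`, the number `wagstaff p` is exactly the rational number `(2 ^ p + 1) / 3`. -/
theorem three_mul_wagstaff {p : ℕ} (hp : Odd p) : 3 * wagstaff p = 2 ^ p + 1 := by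
  have h : (2 + 1) ∣ 2 ^ p + 1 ^ p := hp.nat_add_dvd_pow_add_pow 2 1
  rw [one_pow] at h
  exact Nat.mul_div_cancel' h

/-! Write N for the Wagstaff number and suppose that N is composite. The algebraic factors of 2 ^
12390 - 1 = 3 (N - 1) / 2 supply a completely factored divisor F of N - 1, and Pocklington's
criterion makes every prime factor of N congruent to 1 modulo F. But F is slightly below the fourth
root of N, so this alone decides nothing.

Factors 1 + x F with x < 2 ^ 876 are excluded by Coppersmith's method: an integer polynomial whose
value at x is divisible by a power of the factor, but too small not to vanish, has no root modulo a
small number. If N had three factors, all beyond this bound, the base F digits of (N - 1) / F would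
be the elementary symmetric polynomials of the cofactors x, y, z, and the resulting cubic has no
root modulo 2. So N = p q with large primes p ≤ q (`exists_prime_mul_prime`).

More information comes from N = A ^ 2 + 2 B ^ 2 with B = (2 ^ 6195 + 1) / 3 and A - 1 = -2 B. Let M
be the part of F given by `orderCertificate`; it divides B. Over a prime field of order r, 1 modulo
8, the curve y² = x³ - 4x² + 2x has (a - 1) ^ 2 + 2 b ^ 2 points for some a, b with r = a ^ 2 + 2 b
^ 2 (`cmCurve.exists_card_point`). A point computed modulo N shows that M divides this number; as M
divides r - 1 too, a + b √-2 is 1 modulo M. Hence A + B √-2 is a product of two factors 1 + M (u + v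
√-2) and 1 + M (u' + v' √-2) of norms p and q (`exists_normFactorization`).

This determines u + u' and v + v' modulo M, and the sizes of p and q bound what remains unknown.
Finally G = F / M divides p - 1 and q - 1, which gives a linear congruence modulo G for the two
unknowns. A suitable multiple of it has such small coefficients that it has no solution in the
permitted range (`NormFactorization.not_of_sumCheck`). -/

/-! ### Modular powers for evaluation in the kernel -/

/-- `forced f n` is `f n`, arranged so that the kernel evaluates `n` before it unfolds `f`. -/
def forced {α : Type} (f : ℕ → α) (n : ℕ) : α := Nat.rec (f 0) (fun k _ => f (k + 1)) n

theorem forced_eq {α : Type} (f : ℕ → α) (n : ℕ) : forced f n = f n := by cases n <;> rfl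

/-- Computes `x ^ 2 ^ 2 ^ d * a ^ e` modulo `N` by repeated squaring, halving the exponent. -/
def powAux (N a d : ℕ) : ℕ → ℕ → ℕ :=
  Nat.rec (fun e x => x ^ 2 * a ^ e % N)
    (fun k ih e x => forced (fun e₀ => forced (fun e₁ => forced (ih e₀) (ih e₁ x)) (e / 2 ^ 2 ^ k))
      (e % 2 ^ 2 ^ k)) d

/-- The exponent is split at bit 2 ^ k, and the result for the upper half is the starting value for
the lower half. No bound on e is needed for the congruence; it only keeps the powers at depth 0
small. -/
theorem powAux_modEq (N a d e x : ℕ) : powAux N a d e x ≡ x ^ 2 ^ 2 ^ d * a ^ e [MOD N] := by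
  induction d generalizing e x with
  | zero => simpa [powAux] using Nat.mod_modEq _ _
  | succ k ih =>
    have h : powAux N a (k + 1) e x =
        powAux N a k (e % 2 ^ 2 ^ k) (powAux N a k (e / 2 ^ 2 ^ k) x) := by
      change forced (fun e₀ => forced (fun e₁ => forced (powAux N a k e₀) (powAux N a k e₁ x))
        (e / 2 ^ 2 ^ k)) (e % 2 ^ 2 ^ k) = _
      simp only [forced_eq]
    rw [h]
    refine (ih _ _).trans ?_
    refine (((ih _ _).pow _).mul_right _).trans ?_
    rw [mul_pow, ← pow_mul, ← pow_mul, mul_assoc, ← pow_add, ← pow_add, ← two_mul, ← pow_succ',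
      mul_comm (e / _), Nat.div_add_mod]

/-- `a ^ e` modulo `N`, up to congruence; meant for `e < 2 ^ 2 ^ d`. -/
def powMod (N a e d : ℕ) : ℕ := powAux N a d e 1

theorem powMod_modEq (N a e d : ℕ) : powMod N a e d ≡ a ^ e [MOD N] := by
  simpa [powMod] using powAux_modEq N a d e 1

/-- The depth with which `powMod` handles every exponent of at most `e` in one sweep. -/
def expDepth (e : ℕ) : ℕ := Nat.log2 (Nat.log2 e) + 1

/-! ### Primality certificates -/

/-- A product of distinct primes, each with a primality certificate. The certificate
`pocklington n a l c` of a prime `n` has for `c` a product of primes dividing `n - 1`, the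
certificate `lucas n D x y c` a prime dividing `n + 1`. -/
inductive PrimeProduct : Type
  | small (q : ℕ) : PrimeProduct
  | pocklington (n a l : ℕ) (c : PrimeProduct) : PrimeProduct
  | lucas (n D x y : ℕ) (c : PrimeProduct) : PrimeProduct
  | mul (b c : PrimeProduct) : PrimeProduct

/-- `forcedPair f p` is `f p`, arranged so that the kernel evaluates `p` first. -/
def forcedPair {α : Type} (f : ℕ × ℕ → α) : ℕ × ℕ → α
  | (a, b) => forced (fun a => forced (fun b => f (a, b)) b) a

theorem forcedPair_eq {α : Type} (f : ℕ × ℕ → α) (p : ℕ × ℕ) : forcedPair f p = f p := by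
  simp only [forcedPair, forced_eq]

/-- The power `(p.1 + p.2 √D) ^ e` modulo `n`, for `e < 2 ^ d`. -/
def lucasPow (n D : ℕ) (p : ℕ × ℕ) : ℕ → ℕ → ℕ × ℕ
  | 0, _ => (1, 0)
  | d + 1, e => forcedPair (fun r => forcedPair (fun r => bif e % 2 == 0 then r else
      ((r.1 * p.1 + D * (r.2 * p.2)) % n, (r.1 * p.2 + r.2 * p.1) % n))
        ((r.1 * r.1 + D * (r.2 * r.2)) % n, 2 * r.1 * r.2 % n))
      (forced (lucasPow n D p d) (e / 2))

/-- Checks that some power of the element `x + y √D` of norm 1 has order `s` modulo `n`. -/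
def lucasCheck (n D x y s : ℕ) : Bool :=
  Nat.gcd n (2 * D) == 1 && x * x % n == (D * (y * y) + 1) % n && Nat.blt n ((s - 1) ^ 2) &&
  forced (fun m => forcedPair (fun w => Nat.gcd n w.2 == 1 &&
    forcedPair (fun z => z.1 == 1 && z.2 == 0) (lucasPow n D w (Nat.log2 s + 1) s))
      (lucasPow n D (x, y) (Nat.log2 m + 1) m)) ((n + 1) / s)

namespace PrimeProduct

/-- The value of the product. -/
def value : PrimeProduct → ℕ
  | small q => q
  | pocklington n _ _ _ => n
  | lucas n _ _ _ _ => n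
  | mul b c => value b * value c

/-- The certificate is one for a prime. -/
def isSingle : PrimeProduct → Bool
  | mul _ _ => false
  | _ => true

/-- `g - 1` is prime to `N` for every `g = h ^ (value c / q)`, where `q` is a factor of `c`. -/
def ordersCheck (N : ℕ) : PrimeProduct → ℕ → Bool
  | mul b c, g =>
    forced (fun e => forced (ordersCheck N b) (powMod N g e (expDepth e))) (value c) &&
    forced (fun e => forced (ordersCheck N c) (powMod N g e (expDepth e))) (value b)
  | _, g => Nat.gcd N (g + N - 1) == 1

/-- Checks with the base `a` that the prime factors of `N` are 1 modulo `value c`. -/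
def modOneCheck (N a : ℕ) (c : PrimeProduct) : Bool :=
  forced (fun F => (N - 1) % F == 0 &&
    forced (fun e => forced (fun g => powMod N g F (expDepth F) == 1 && ordersCheck N c g)
      (powMod N a e (expDepth e))) ((N - 1) / F)) (value c)

/-- There are no `x, y` with `x + y = v` and `x * y = u`, by the discriminant modulo `l`. -/
def discrCheck (u v l : ℕ) : Bool :=
  (u == 0) || (l != 0 && (List.range l).all fun z => (z ^ 2 + 4 * u) % l != v ^ 2 % l)

/-- Checks every certificate. -/
def check : PrimeProduct → Bool
  | small q => Nat.blt 1 q && Nat.blt q 2500 &&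
      (List.range 50).all fun m => Nat.blt m 2 || q % m != 0 || Nat.ble q m
  | pocklington n a l c => check c && modOneCheck n a c && Nat.blt 1 n &&
      forced (fun F => forced (fun R => Nat.blt (R / F + 1) F && discrCheck (R / F) (R % F) l)
        ((n - 1) / F)) (value c)
  | lucas n D x y c => check c && isSingle c && Nat.blt 1 n && lucasCheck n D x y (value c)
  | mul b c => Nat.gcd (value b) (value c) == 1 && check b && check c

end PrimeProduct

/-! ### Soundness of the certificates from n - 1 -/

theorem Nat.Prime.of_small {q : ℕ} (h1 : 1 < q) (h2 : q < 2500)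
    (h : ∀ m < 50, 2 ≤ m → q % m = 0 → q ≤ m) : q.Prime := by
  rw [Nat.prime_def_le_sqrt]
  refine ⟨h1, fun m hm hs hd => ?_⟩
  have h3 : m * m ≤ q := Nat.le_sqrt.1 hs
  have h4 : m < 50 := by nlinarith
  have := h m h4 hm (Nat.mod_eq_zero_of_dvd hd)
  nlinarith

/-- Two factors that are 1 modulo `F` and large: the sum and the product of their quotients. -/
theorem add_eq_mod_and_mul_eq_div {F R T x y : ℕ} (h : R = x + y + F * (x * y)) (hF : 0 < F)
    (hT : 0 < T) (hx : T ≤ x) (hy : T ≤ y) (hR : R / F / T + T < F) :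
    x + y = R % F ∧ x * y = R / F := by
  have h1 : x * y ≤ R / F := by
    rw [Nat.le_div_iff_mul_le hF]
    nlinarith
  have h2 : x + y < F := by
    refine lt_of_le_of_lt ?_ hR
    obtain ⟨s, rfl⟩ := Nat.exists_eq_add_of_le hx
    obtain ⟨t, rfl⟩ := Nat.exists_eq_add_of_le hy
    have h3 : T + s + t ≤ R / F / T := by
      rw [Nat.le_div_iff_mul_le hT]
      nlinarith [Nat.zero_le (s * t)]
    omega
  rw [h, Nat.add_mul_mod_self_left, Nat.mod_eq_of_lt h2, Nat.add_mul_div_left _ _ hF,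
    Nat.div_eq_of_lt h2]
  simp

/-- The shape of a composite number all of whose prime factors are 1 modulo `F`. -/
theorem exists_eq_mul_of_not_prime {N F : ℕ} (hN : 1 < N) (hF : 0 < F) (hp : ¬ N.Prime)
    (h : ∀ p, p.Prime → p ∣ N → F ∣ p - 1) :
    ∃ x y, 0 < x ∧ x ≤ y ∧ 1 + x * F = N.minFac ∧ N = (1 + x * F) * (1 + y * F) := by
  have h1 : N.minFac.Prime := Nat.minFac_prime hN.ne'
  obtain ⟨x, hx⟩ := h _ h1 N.minFac_dvd
  have e1 : N.minFac = 1 + x * F := by have := h1.two_le; rw [mul_comm]; omega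
  obtain ⟨m, hm⟩ := N.minFac_dvd
  have hm1 : N.minFac ≤ m := by
    have := Nat.minFac_sq_le_self (by omega) hp
    rw [sq] at this
    conv_rhs at this => rw [hm]
    exact Nat.le_of_mul_le_mul_left this h1.pos
  -- The condition passes from the prime factors to all divisors by multiplicativity; it is needed
  -- for the cofactor m, which may be composite.
  have key : ∀ m : ℕ, m ≠ 0 → (∀ p, p.Prime → p ∣ m → F ∣ p - 1) → 1 ≡ m [MOD F] := by
    intro m
    induction m using Nat.recOnMul with
    | zero => simp
    | one => intros; rfl
    | prime p hp =>
      intro _ H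
      exact (Nat.modEq_iff_dvd' hp.one_lt.le).2 (H p hp dvd_rfl)
    | mul a b iha ihb =>
      intro hab H
      have := (iha (left_ne_zero_of_mul hab) fun p hp hd => H p hp (hd.mul_right _)).mul
        (ihb (right_ne_zero_of_mul hab) fun p hp hd => H p hp (hd.mul_left _))
      simpa using this
  have hm0 : 1 ≤ m := h1.one_lt.le.trans hm1
  have h2 := key m (by omega) fun p hp hd => h p hp (hd.trans ⟨_, by rw [mul_comm, ← hm]⟩)
  obtain ⟨y, hy⟩ := (Nat.modEq_iff_dvd' hm0).1 h2
  have e2 : m = 1 + y * F := by rw [mul_comm]; omega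
  refine ⟨x, y, ?_, ?_, e1.symm, ?_⟩
  · rcases Nat.eq_zero_or_pos x with rfl | hx0
    · exact absurd h1 (by rw [e1]; simp [Nat.not_prime_one])
    · exact hx0
  · rw [e1, e2] at hm1
    exact Nat.le_of_mul_le_mul_right (by omega) hF
  · rw [← e1, ← e2]; exact hm

namespace PrimeProduct

theorem natCast_powMod {N p : ℕ} (hp : p ∣ N) (a e d : ℕ) :
    ((powMod N a e d : ℕ) : ZMod p) = (a : ZMod p) ^ e := by
  rw [← Nat.cast_pow]
  exact (ZMod.natCast_eq_natCast_iff _ _ _).2 ((powMod_modEq N a e d).of_dvd hp)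

/-- The term g + N - 1 stands for g - 1 and avoids truncated subtraction at g = 0. -/
theorem cast_ne_one {N p g : ℕ} (hp : p.Prime) (h : p ∣ N) (hN : 0 < N)
    (hg : Nat.gcd N (g + N - 1) = 1) : (g : ZMod p) ≠ 1 := by
  intro h1
  have h2 : p ∣ g + N - 1 := by
    rw [← ZMod.natCast_eq_zero_iff, Nat.add_sub_assoc hN, Nat.cast_add, h1, Nat.cast_sub hN,
      (ZMod.natCast_eq_zero_iff _ _).2 h]
    simp
  exact hp.one_lt.ne' (Nat.dvd_one.1 (hg ▸ Nat.dvd_gcd h h2))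

theorem dvd_sub_one_of_pow {p q : ℕ} (hp : p.Prime) (hq : q.Prime) {g : ZMod p} (h1 : g ≠ 1)
    (h : g ^ q = 1) : q ∣ p - 1 := by
  have := Fact.mk hp
  have := Fact.mk hq
  rw [← orderOf_eq_prime h h1]
  refine ZMod.orderOf_dvd_card_sub_one ?_
  rintro rfl
  simp [hq.ne_zero] at h

theorem forced_eq' {α : Type} : @forced α = fun f n => f n := by
  funext f n; exact forced_eq f n

/-- The factors are distinct primes. -/
def Sound : PrimeProduct → Prop
  | small q => q.Prime
  | pocklington n _ _ _ => n.Prime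
  | lucas n _ _ _ _ => n.Prime
  | mul b c => (value b).Coprime (value c) ∧ Sound b ∧ Sound c

theorem Sound.prime_of_isSingle : ∀ {c : PrimeProduct}, c.Sound → c.isSingle = true →
    c.value.Prime
  | small _, h, _ => h
  | pocklington _ _ _ _, h, _ => h
  | lucas _ _ _ _ _, h, _ => h

theorem Sound.value_pos : ∀ {c : PrimeProduct}, c.Sound → 0 < c.value
  | small _, h => Nat.Prime.pos h
  | pocklington _ _ _ _, h => Nat.Prime.pos h
  | lucas _ _ _ _ _, h => Nat.Prime.pos h
  | mul _ _, h => Nat.mul_pos h.2.1.value_pos h.2.2.value_pos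

/-- On the way down the product tree, g is raised to the value of the other branch. At the leaf of q
it has become an element different from 1 whose q-th power is 1, so its order is q. Coprimality of
the branches assembles the primes. -/
theorem value_dvd_of_ordersCheck {N p : ℕ} (hp : p.Prime) (hN : p ∣ N) (h0 : 0 < N) :
    ∀ (c : PrimeProduct) (g : ℕ), c.Sound → ordersCheck N c g = true →
      (g : ZMod p) ^ c.value = 1 → c.value ∣ p - 1
  | small _, _, hs, hc, hg =>
    dvd_sub_one_of_pow hp hs (cast_ne_one hp hN h0 (by simpa [ordersCheck] using hc)) hg
  | pocklington _ _ _ _, _, hs, hc, hg =>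
    dvd_sub_one_of_pow hp hs (cast_ne_one hp hN h0 (by simpa [ordersCheck] using hc)) hg
  | lucas _ _ _ _ _, _, hs, hc, hg =>
    dvd_sub_one_of_pow hp hs (cast_ne_one hp hN h0 (by simpa [ordersCheck] using hc)) hg
  | mul b c, g, hs, hc, hg => by
    simp only [ordersCheck, forced_eq', Bool.and_eq_true] at hc
    refine hs.1.mul_dvd_of_dvd_of_dvd
      (value_dvd_of_ordersCheck hp hN h0 b _ hs.2.1 hc.1 ?_)
      (value_dvd_of_ordersCheck hp hN h0 c _ hs.2.2 hc.2 ?_)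
    · rw [natCast_powMod hN, ← pow_mul, mul_comm]; exact hg
    · rw [natCast_powMod hN, ← pow_mul]; exact hg

theorem value_dvd_of_modOneCheck {N a : ℕ} {c : PrimeProduct} (hs : c.Sound) (h0 : 0 < N)
    (h : modOneCheck N a c = true) :
    c.value ∣ N - 1 ∧ ∀ p, p.Prime → p ∣ N → c.value ∣ p - 1 := by
  simp only [modOneCheck, forced_eq', Bool.and_eq_true, beq_iff_eq] at h
  refine ⟨Nat.dvd_of_mod_eq_zero h.1, fun p hp hN => ?_⟩
  refine value_dvd_of_ordersCheck hp hN h0 c _ hs h.2.2 ?_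
  rw [← natCast_powMod hN _ _ (expDepth c.value), h.2.1, Nat.cast_one]

/-- The discriminant (x + y) ^ 2 - 4 x y is the square of y - x, so it must be a square modulo l. -/
theorem not_of_discrCheck {u v l x y : ℕ} (h : discrCheck u v l = true) (hx : 0 < x)
    (hy : 0 < y) (hs : x + y = v) (hm : x * y = u) : False := by
  subst hs hm
  simp only [discrCheck, Bool.or_eq_true, beq_iff_eq, Bool.and_eq_true, bne_iff_ne,
    List.all_eq_true, List.mem_range] at h
  rcases h with h | ⟨h0, h⟩
  · exact absurd h (Nat.mul_pos hx hy).ne'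
  · wlog hxy : x ≤ y generalizing x y
    · exact this hy hx (by simpa only [mul_comm, add_comm] using h) (by omega)
    obtain ⟨t, rfl⟩ := Nat.exists_eq_add_of_le hxy
    refine h (t % l) (Nat.mod_lt _ (Nat.pos_of_ne_zero h0)) ?_
    have e : (x + (x + t)) ^ 2 = t ^ 2 + 4 * (x * (x + t)) := by ring
    rw [e]
    exact ((Nat.mod_modEq t l).pow 2).add_right _

/-! ### Soundness of the certificates from n + 1 -/

section Lucas

open QuadraticAlgebra

theorem mk_lucasPow {n p D : ℕ} (hp : p ∣ n) (t : ℕ × ℕ) (d e : ℕ) (he : e < 2 ^ d) :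
    (⟨(lucasPow n D t d e).1, (lucasPow n D t d e).2⟩ : QuadraticAlgebra (ZMod p) D 0) =
      ⟨t.1, t.2⟩ ^ e := by
  have hc : ∀ a : ℕ, ((a % n : ℕ) : ZMod p) = a := fun a =>
    (ZMod.natCast_eq_natCast_iff _ _ _).2 ((Nat.mod_modEq a n).of_dvd hp)
  induction d generalizing e with
  | zero =>
    have : e = 0 := by simpa using he
    subst this
    ext <;> simp [lucasPow]
  | succ d ih =>
    have h1 := ih (e / 2) (by rw [pow_succ] at he; omega)
    have e1 : e = 2 * (e / 2) + e % 2 := (Nat.div_add_mod e 2).symm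
    have h2 : ∀ z : QuadraticAlgebra (ZMod p) D 0, z ^ e = (z ^ (e / 2)) ^ 2 * z ^ (e % 2) :=
      fun z => by conv_lhs => rw [e1, pow_add, mul_comm 2, pow_mul]
    rw [h2, ← h1]
    simp only [lucasPow, forcedPair_eq, forced_eq]
    rcases Nat.mod_two_eq_zero_or_one e with h0 | h0 <;> simp only [h0]
    · ext <;> simp [hc, sq] <;> ring
    · ext <;> simp [hc, sq] <;> ring

/-- An element z of norm 1 has its conjugate as inverse, and Frobenius maps z to itself or to its
conjugate. So z ^ (p - 1) or z ^ (p + 1) is 1, while a power of z has order s. Whether D is a square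
modulo p, that is, whether the algebra is a field, plays no role. -/
theorem dvd_of_lucasCheck {n D x y s p : ℕ} (hp : p.Prime) (hn : p ∣ n) (hs : s.Prime)
    (h : lucasCheck n D x y s = true) : s ∣ p - 1 ∨ s ∣ p + 1 := by
  simp only [lucasCheck, forcedPair_eq, forced_eq, Bool.and_eq_true, beq_iff_eq] at h
  obtain ⟨⟨⟨h1, h2⟩, -⟩, h3, h4, h5⟩ := h
  have := Fact.mk hp
  have hu : ∀ a : ℕ, Nat.gcd n a = 1 → (a : ZMod p) ≠ 0 := fun a ha h0 =>
    hp.one_lt.ne' (Nat.dvd_one.1 (ha ▸ Nat.dvd_gcd hn ((ZMod.natCast_eq_zero_iff _ _).1 h0)))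
  have h2D := hu _ h1
  rw [Nat.cast_mul] at h2D
  have hD : (D : ZMod p) ≠ 0 := right_ne_zero_of_mul h2D
  have hodd : Odd p := hp.odd_of_ne_two fun h => left_ne_zero_of_mul h2D (by
    subst h; rfl)
  have hch : CharP (QuadraticAlgebra (ZMod p) D 0) p := charP_of_injective_algebraMap
    (algebraMap_injective (R := ZMod p) (a := (D : ZMod p)) (b := 0)) p
  set z : QuadraticAlgebra (ZMod p) D 0 := ⟨x, y⟩ with hz
  set z' : QuadraticAlgebra (ZMod p) D 0 := ⟨x, -y⟩ with hz'
  have hnorm : z * z' = 1 := by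
    have h6 : ((x * x : ℕ) : ZMod p) = ((D * (y * y) + 1 : ℕ) : ZMod p) :=
      (ZMod.natCast_eq_natCast_iff _ _ _).2 (Nat.ModEq.of_dvd hn h2)
    push_cast at h6
    ext
    · simp [hz, hz', h6]; ring
    · simp [hz, hz']; ring
  set g : QuadraticAlgebra (ZMod p) D 0 := ⟨0, 1⟩ with hg
  have hg2 : g ^ 2 = algebraMap (ZMod p) (QuadraticAlgebra (ZMod p) D 0) D := by
    rw [algebraMap_eq]
    ext <;> simp [hg, sq]
  have e1 : z = algebraMap (ZMod p) (QuadraticAlgebra (ZMod p) D 0) x + algebraMap (ZMod p) (QuadraticAlgebra (ZMod p) D 0) y * g := by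
    rw [algebraMap_eq, algebraMap_eq]
    ext <;> simp [hz, hg]
  have e2 : z' = algebraMap (ZMod p) (QuadraticAlgebra (ZMod p) D 0) x - algebraMap (ZMod p) (QuadraticAlgebra (ZMod p) D 0) y * g := by
    rw [algebraMap_eq, algebraMap_eq]
    ext <;> simp [hz', hg]
  have hfrob : z ^ p = z ∨ z ^ p = z' := by
    have h7 : g ^ p = g ∨ g ^ p = -g := by
      obtain ⟨k, hk⟩ := hodd
      have h8 : g ^ p = algebraMap (ZMod p) (QuadraticAlgebra (ZMod p) D 0) ((D : ZMod p) ^ k) * g := by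
        rw [map_pow, ← hg2, ← pow_mul, ← pow_succ, ← hk]
      -- Euler's criterion in weak form: D ^ ((p - 1) / 2) is 1 or -1.
      have h9 : ((D : ZMod p) ^ k) ^ 2 = 1 := by
        rw [← pow_mul, mul_comm, show 2 * k = p - 1 by omega, ZMod.pow_card_sub_one_eq_one hD]
      rcases mul_self_eq_one_iff.1 ((sq _).symm.trans h9) with h | h
      · left; rw [h8, h, map_one, one_mul]
      · right; rw [h8, h, map_neg, map_one, neg_one_mul]
    have h8 : z ^ p = algebraMap (ZMod p) (QuadraticAlgebra (ZMod p) D 0) x + algebraMap (ZMod p) (QuadraticAlgebra (ZMod p) D 0) y * g ^ p := by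
      rw [e1, add_pow_char, mul_pow, ← map_pow, ← map_pow, ZMod.pow_card, ZMod.pow_card]
    rcases h7 with h | h
    · left; rw [h8, h, ← e1]
    · right; rw [h8, h, e2]; ring
  have hm := mk_lucasPow (D := D) hn (x, y) (Nat.log2 ((n + 1) / s) + 1) ((n + 1) / s)
    Nat.lt_log2_self
  set w := lucasPow n D (x, y) (Nat.log2 ((n + 1) / s) + 1) ((n + 1) / s)
  have hm' := mk_lucasPow (D := D) hn w (Nat.log2 s + 1) s Nat.lt_log2_self
  rw [h4, h5, hm] at hm'
  have hw : (z ^ ((n + 1) / s)) ^ s = 1 := by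
    rw [← hm']
    ext <;> simp
  have hw1 : z ^ ((n + 1) / s) ≠ 1 := by
    rw [← hm]
    intro h
    exact hu _ h3 (by simpa using congrArg QuadraticAlgebra.im h)
  have := Fact.mk hs
  have hord := orderOf_eq_prime hw hw1
  rw [← hord]
  rcases hfrob with h | h
  · left
    refine orderOf_dvd_of_pow_eq_one ?_
    have h9 : z ^ (p - 1) = 1 := by
      have h10 : z ^ (p - 1) * z = z := by rw [← pow_succ, Nat.sub_add_cancel hp.one_lt.le, h]
      calc z ^ (p - 1) = z ^ (p - 1) * z * z' := by rw [mul_assoc, hnorm, mul_one]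
        _ = 1 := by rw [h10, hnorm]
    rw [← pow_mul, mul_comm, pow_mul, h9, one_pow]
  · right
    refine orderOf_dvd_of_pow_eq_one ?_
    rw [← pow_mul, mul_comm, pow_mul, pow_succ, h, mul_comm, hnorm, one_pow]

/-- A prime factor p with s dividing p - 1 or p + 1 is at least s - 1, while the least factor of a
composite n is below s - 1. -/
theorem prime_of_lucasCheck {n D x y s : ℕ} (hn : 1 < n) (hs : s.Prime)
    (h : lucasCheck n D x y s = true) : n.Prime := by
  have h1 : n < (s - 1) ^ 2 := by
    simp only [lucasCheck, Bool.and_eq_true, Nat.blt_eq] at h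
    exact h.1.2
  by_contra hc
  have hp := Nat.minFac_prime hn.ne'
  have h2 := Nat.minFac_sq_le_self (by omega) hc
  have h3 : n.minFac < s - 1 := lt_of_pow_lt_pow_left₀ 2 (Nat.zero_le _) (h2.trans_lt h1)
  have h4 := hp.two_le
  rcases dvd_of_lucasCheck hp n.minFac_dvd hs h with h5 | h5
  · have := Nat.le_of_dvd (by omega) h5
    omega
  · have := Nat.le_of_dvd (by omega) h5
    omega

end Lucas

theorem sound_of_check : ∀ c : PrimeProduct, c.check = true → c.Sound
  | small q, h => by
    simp only [check, Bool.and_eq_true, Nat.blt_eq, List.all_eq_true, List.mem_range,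
      Bool.or_eq_true, Nat.ble_eq, bne_iff_ne] at h
    refine Nat.Prime.of_small h.1.1 h.1.2 fun m hm h2 h3 => ?_
    rcases h.2 m hm with (h4 | h4) | h4
    · omega
    · exact absurd h3 h4
    · exact h4
  | mul b c, h => by
    simp only [check, Bool.and_eq_true, beq_iff_eq] at h
    exact ⟨h.1.1, sound_of_check b h.1.2, sound_of_check c h.2⟩
  | lucas n D x y c, h => by
    simp only [check, Bool.and_eq_true, Nat.blt_eq] at h
    exact prime_of_lucasCheck h.1.2 ((sound_of_check c h.1.1.1).prime_of_isSingle h.1.1.2) h.2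
  | pocklington n a l c, h => by
    simp only [check, forced_eq', Bool.and_eq_true, Nat.blt_eq] at h
    have hs := sound_of_check c h.1.1.1
    have hn : 1 < n := h.1.2
    have hF := hs.value_pos
    obtain ⟨⟨R, hR⟩, hp⟩ := value_dvd_of_modOneCheck hs (zero_lt_one.trans hn) h.1.1.2
    by_contra hc
    obtain ⟨x, y, hx, hxy, -, e⟩ := exists_eq_mul_of_not_prime hn hF hc hp
    have hR' : R = x + y + c.value * (x * y) := by
      refine Nat.eq_of_mul_eq_mul_left hF ?_
      rw [← hR, Nat.sub_eq_iff_eq_add hn.le, e]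
      ring
    rw [hR, Nat.mul_div_cancel_left _ hF] at h
    -- Only x, y ≥ 1 is known here, so the lower bound is 1. The size condition then amounts to
    -- roughly n < F ^ 3.
    obtain ⟨h1, h2⟩ := add_eq_mod_and_mul_eq_div hR' hF one_pos hx (hx.trans_le hxy)
      (by simpa using h.2.1)
    exact not_of_discrCheck h.2.2 hx (hx.trans_le hxy) h1 h2

end PrimeProduct

/-! ### Exclusion of small factors by Coppersmith's method -/

/-- `forcedInt f z` is `f z`, arranged so that the kernel evaluates `z` first. -/
def forcedInt {α : Type} (f : ℤ → α) : ℤ → α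
  | Int.ofNat n => forced (fun n => f (Int.ofNat n)) n
  | Int.negSucc n => forced (fun n => f (Int.negSucc n)) n

theorem forcedInt_eq {α : Type} (f : ℤ → α) (z : ℤ) : forcedInt f z = f z := by
  cases z <;> simp only [forcedInt, forced_eq]

/-- `forcedList f l` is `f l`, arranged so that the kernel evaluates `l` first. -/
def forcedList {α : Type} (f : List ℤ → α) : List ℤ → α
  | [] => f []
  | a :: l => forcedInt (fun a => forcedList (fun l => f (a :: l)) l) a

theorem forcedList_eq {α : Type} (f : List ℤ → α) (l : List ℤ) : forcedList f l = f l := by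
  induction l generalizing f with
  | nil => rfl
  | cons a l ih => exact (forcedInt_eq _ _).trans (ih _)

/-! Integer polynomials as lists of coefficients, constant term first. -/

namespace CoeffList

/-- The value at `x`. -/
def eval (x : ℤ) : List ℤ → ℤ
  | [] => 0
  | c :: l => c + x * eval x l

/-- The polynomial `p + a * q`. -/
def addMul (a : ℤ) : List ℤ → List ℤ → List ℤ
  | p, [] => p
  | [], d :: q => a * d :: addMul a [] q
  | c :: p, d :: q => (c + a * d) :: addMul a p q

theorem eval_addMul (x a : ℤ) (p q : List ℤ) :
    eval x (addMul a p q) = eval x p + a * eval x q := by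
  induction q generalizing p with
  | nil => cases p <;> simp [addMul, eval]
  | cons d q ih => cases p <;> simp only [addMul, eval, ih] <;> ring

/-- The polynomial `(X - R) ^ i`. -/
def linearPow (R : ℤ) : ℕ → List ℤ
  | 0 => [1]
  | i + 1 => forcedList (fun l => addMul (-R) (0 :: l) l) (linearPow R i)

theorem eval_linearPow (x R : ℤ) (i : ℕ) : eval x (linearPow R i) = (x - R) ^ i := by
  induction i with
  | zero => simp [linearPow, eval]
  | succ i ih =>
    rw [linearPow, forcedList_eq, eval_addMul, eval, ih]
    ring

/-- The coefficient of `X ^ i`. -/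
def coeff (p : List ℤ) (i : ℕ) : ℤ := p.getD i 0

/-- There is no root modulo `l`. -/
def noRootMod (l : ℕ) (p : List ℤ) : Bool :=
  l != 0 && forcedList (fun q => (List.range l).all fun z => eval z q % l != 0) (p.map (· % (l : ℤ)))

theorem eval_map_emod (l : ℕ) (x : ℤ) (p : List ℤ) :
    eval x (p.map (· % (l : ℤ))) ≡ eval x p [ZMOD l] := by
  induction p with
  | nil => rfl
  | cons c p ih => exact (Int.mod_modEq c l).add (ih.mul_left x)

theorem eval_modEq {l x y : ℤ} (h : x ≡ y [ZMOD l]) (p : List ℤ) :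
    eval x p ≡ eval y p [ZMOD l] := by
  induction p with
  | nil => rfl
  | cons c p ih => exact (h.mul ih).add_left c

theorem eval_ne_zero_of_noRootMod {l : ℕ} {p : List ℤ} (h : noRootMod l p = true) (x : ℤ) :
    eval x p ≠ 0 := by
  simp only [noRootMod, forcedList_eq, Bool.and_eq_true, bne_iff_ne, List.all_eq_true,
    List.mem_range] at h
  intro h0
  have hl : (l : ℤ) ≠ 0 := by exact_mod_cast h.1
  obtain ⟨z, hz⟩ := Int.eq_ofNat_of_zero_le (Int.emod_nonneg x hl)
  have hzl : z < l := by
    have := Int.emod_lt_of_pos x (by omega : (0 : ℤ) < l)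
    omega
  refine h.2 z hzl ?_
  have h1 : (z : ℤ) ≡ x [ZMOD l] := hz ▸ Int.mod_modEq x l
  have h2 := (eval_map_emod l z p).trans (eval_modEq h1 p)
  rw [h0] at h2
  simpa [Int.ModEq] using h2

/-- Adds to `p` multiples of `N ^ (k - i) * (X - R) ^ i` for the `i < m`, in descending order, so
that the coefficient of `X ^ i` becomes its residue modulo `N ^ (k - i)`, plus `N ^ (k - i)` times
the next entry of the list. -/
def reduce (N R : ℤ) (k : ℕ) : ℕ → List ℤ → List ℤ → List ℤ
  | i + 1, s :: l, p =>
    forcedInt (fun M => forcedInt (fun a => forcedList (reduce N R k i l)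
      (addMul a p (linearPow R i))) (M * (s - coeff p i / M))) (N ^ (k - i))
  | _, _, p => p

/-- Each added multiple of N ^ (k - i) (x - R) ^ i is divisible by p ^ k; for i > k the truncated k
- i is 0 and the second factor suffices. As these polynomials form a triangular basis, a short
lattice vector is recovered from its coefficients in degrees i ≥ k, where the modulus is 1; below
that only the choice of residues is recorded. -/
theorem dvd_eval_reduce {N R x p : ℤ} (hN : p ∣ N) (hR : p ∣ x - R) (k : ℕ) (m : ℕ) (l : List ℤ)
    (q : List ℤ) (hq : p ^ k ∣ eval x q) : p ^ k ∣ eval x (reduce N R k m l q) := by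
  induction m generalizing l q with
  | zero => exact hq
  | succ i ih =>
    cases l with
    | nil => exact hq
    | cons s l =>
      rw [reduce, forcedInt_eq, forcedInt_eq, forcedList_eq]
      refine ih _ _ ?_
      rw [eval_addMul, eval_linearPow]
      refine dvd_add hq ?_
      rw [mul_right_comm]
      refine Dvd.dvd.mul_right ?_ _
      refine (pow_dvd_pow p (by omega : k ≤ (k - i) + i)).trans ?_
      rw [pow_add]
      exact mul_dvd_mul (pow_dvd_pow_of_dvd hN _) (pow_dvd_pow_of_dvd hR _)

theorem eval_nonneg {x : ℤ} (hx : 0 ≤ x) {w : List ℤ} (h : ∀ c ∈ w, 0 ≤ c) : 0 ≤ eval x w := by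
  induction w with
  | nil => exact le_rfl
  | cons c w ih =>
    simp only [List.mem_cons, forall_eq_or_imp] at h
    exact add_nonneg h.1 (mul_nonneg hx (ih h.2))

theorem eval_mono {x y : ℤ} (hx : 0 ≤ x) (hxy : x ≤ y) {w : List ℤ} (h : ∀ c ∈ w, 0 ≤ c) :
    eval x w ≤ eval y w := by
  induction w with
  | nil => exact le_rfl
  | cons c w ih =>
    simp only [List.mem_cons, forall_eq_or_imp] at h
    exact add_le_add_right (mul_le_mul hxy (ih h.2) (eval_nonneg hx h.2) (hx.trans hxy)) _

theorem eval_append (x : ℤ) (p q : List ℤ) :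
    eval x (p ++ q) = eval x p + x ^ p.length * eval x q := by
  induction p with
  | nil => simp [eval]
  | cons c p ih => simp only [List.cons_append, eval, ih, List.length_cons]; ring

/-- For a polynomial of degree below k with nonnegative coefficients, division by x ^ k gives a
decreasing function. -/
theorem pow_mul_eval_le {x y : ℤ} (hx : 0 ≤ x) (hxy : x ≤ y) {w : List ℤ} (h : ∀ c ∈ w, 0 ≤ c)
    (k : ℕ) (hk : w.length ≤ k) : x ^ k * eval y w ≤ y ^ k * eval x w := by
  induction w generalizing k with
  | nil => simp [eval]
  | cons c w ih =>
    obtain ⟨k, rfl⟩ : ∃ j, k = j + 1 := ⟨k - 1, by simp only [List.length_cons] at hk; omega⟩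
    simp only [List.mem_cons, forall_eq_or_imp] at h
    simp only [List.length_cons, add_le_add_iff_right] at hk
    have h1 := ih h.2 k hk
    have h2 : x ^ (k + 1) * c ≤ y ^ (k + 1) * c :=
      mul_le_mul_of_nonneg_right (pow_le_pow_left₀ hx hxy _) h.1
    have h3 := mul_le_mul_of_nonneg_left h1 (mul_nonneg hx (hx.trans hxy))
    simp only [eval, mul_add]
    have e1 : x ^ (k + 1) * (y * eval y w) = x * y * (x ^ k * eval y w) := by ring
    have e2 : y ^ (k + 1) * (x * eval x w) = x * y * (y ^ k * eval x w) := by ring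
    rw [e1, e2]
    exact add_le_add h2 h3

/-- Checks `L * w(x) < K * x ^ k` for all `x` between `A` and `B`, where `w` has nonnegative
coefficients. -/
def boundCheck (k : ℕ) (A B K L : ℤ) (w : List ℤ) : Bool :=
  decide (L * (eval A (w.take k) + A ^ k * eval B (w.drop k)) < K * A ^ k)

theorem lt_of_boundCheck {k : ℕ} {A B K L x : ℤ} {w : List ℤ} (h : ∀ c ∈ w, 0 ≤ c) (hA : 0 < A)
    (hL : 0 ≤ L) (hAx : A ≤ x) (hxB : x ≤ B) (hc : boundCheck k A B K L w = true) :
    L * eval x w < K * x ^ k := by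
  have hc' := of_decide_eq_true hc
  have hx : 0 < x := hA.trans_le hAx
  have h1 : ∀ c ∈ w.take k, 0 ≤ c := fun c hc => h c (List.mem_of_mem_take hc)
  have h2 : ∀ c ∈ w.drop k, 0 ≤ c := fun c hc => h c (List.mem_of_mem_drop hc)
  -- After division by x ^ k, the terms of degree below k are largest at A and the others at B.
  have h3 : eval x w ≤ eval x (w.take k) + x ^ k * eval x (w.drop k) := by
    conv_lhs => rw [← List.take_append_drop k w]
    rw [eval_append]
    by_cases hk : k ≤ w.length
    · rw [List.length_take_of_le hk]
    · rw [List.drop_of_length_le (by omega)]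
      simp [eval]
  have h4 := pow_mul_eval_le hA.le hAx h1 k (List.length_take_le k w)
  have h5 := eval_mono hx.le hxB h2
  have hAk : 0 < A ^ k := pow_pos hA k
  have hxk : 0 < x ^ k := pow_pos hx k
  refine lt_of_mul_lt_mul_left ?_ hAk.le
  calc A ^ k * (L * eval x w) ≤ A ^ k * (L * (eval x (w.take k) + x ^ k * eval B (w.drop k))) := by
        gcongr
        exact h3.trans (by gcongr)
    _ = L * (A ^ k * eval x (w.take k) + A ^ k * x ^ k * eval B (w.drop k)) := by ring
    _ ≤ L * (x ^ k * eval A (w.take k) + A ^ k * x ^ k * eval B (w.drop k)) := by gcongr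
    _ = x ^ k * (L * (eval A (w.take k) + A ^ k * eval B (w.drop k))) := by ring
    _ < x ^ k * (K * A ^ k) := by gcongr
    _ = A ^ k * (K * x ^ k) := by ring

/-- The absolute values of the coefficients. -/
def absList (p : List ℤ) : List ℤ := p.map fun c => |c|

theorem nonneg_of_mem_absList {p : List ℤ} : ∀ c ∈ absList p, 0 ≤ c := by
  simp only [absList, List.mem_map]
  rintro c ⟨d, -, rfl⟩
  exact abs_nonneg d

theorem abs_eval_le {x B : ℤ} (h : |x| ≤ B) (p : List ℤ) : |eval x p| ≤ eval B (absList p) := by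
  induction p with
  | nil => simp [eval, absList]
  | cons c p ih =>
    refine (abs_add_le _ _).trans (add_le_add_right ?_ _)
    rw [abs_mul]
    exact mul_le_mul h ih (abs_nonneg _) ((abs_nonneg _).trans h)

end CoeffList

/-- Data that excludes the factors `1 + x * F` of a number, for all `x` from some bound to the bound
`top`: the multiplicity `mult`, the description of a polynomial, and a modulus for which this has no
roots. -/
structure FactorFree : Type where
  /-- The upper bound. -/
  top : ℕ
  /-- The multiplicity with which the factors divide the values of the polynomial. -/
  mult : ℕ
  /-- A modulus. -/
  modulus : ℕ
  /-- The input of `CoeffList.reduce`. -/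
  quotients : List ℤ

namespace FactorFree

/-- Checks that `N = 1 + F * R` has no factor `1 + x * F` with `A ≤ x ≤ d.top`. -/
def check (N F R A : ℕ) (d : FactorFree) : Bool :=
  forcedList (fun p => CoeffList.noRootMod d.modulus p &&
    CoeffList.boundCheck d.mult A d.top (F ^ d.mult) 1 (CoeffList.absList p))
      (CoeffList.reduce N R d.mult d.quotients.length d.quotients [])

/-- For P = 1 + x F one has P ∣ N and R - x = y P, so P ^ k divides the value h(x) of the reduced
polynomial h. If x were in the interval, then |h(x)| < (x F) ^ k ≤ P ^ k would force h(x) = 0, but h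
has no root modulo the given modulus. -/
theorem not_of_check {N F R A x y : ℕ} {d : FactorFree} (h : d.check N F R A = true)
    (hN : N = (1 + x * F) * (1 + y * F)) (hR : R = x + y + F * (x * y)) (hA : 0 < A)
    (hx : A ≤ x) : d.top ≤ x := by
  by_contra! hxt
  simp only [check, forcedList_eq, Bool.and_eq_true] at h
  refine CoeffList.eval_ne_zero_of_noRootMod h.1 x (Int.eq_zero_of_abs_lt_dvd
    (m := ((1 + x * F : ℕ) : ℤ) ^ d.mult) (CoeffList.dvd_eval_reduce ?_ ?_ _ _ _ _ (by
      simp [CoeffList.eval])) ?_)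
  · rw [hN]; exact_mod_cast Dvd.intro _ rfl
  · refine ⟨-y, ?_⟩
    rw [hR]; push_cast; ring
  · have h1 := CoeffList.lt_of_boundCheck CoeffList.nonneg_of_mem_absList
      (x := x) (by exact_mod_cast hA) zero_le_one
      (by exact_mod_cast hx) (by exact_mod_cast hxt.le) h.2
    rw [one_mul, ← mul_pow] at h1
    refine (CoeffList.abs_eval_le (by simp) _).trans_lt (h1.trans_le ?_)
    gcongr
    push_cast
    linarith [mul_comm (F : ℤ) x]

/-- Checks a list of data for adjacent intervals, the first of which starts at `A`, and then `f` for
the end of the last interval. -/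
def checkAll (N F R : ℕ) (f : ℕ → Bool) : ℕ → List FactorFree → Bool
  | A, [] => f A
  | A, d :: l => check N F R A d && checkAll N F R f d.top l

theorem exists_le_of_checkAll {N F R x y : ℕ} {f : ℕ → Bool} {l : List FactorFree} {A : ℕ}
    (hN : N = (1 + x * F) * (1 + y * F)) (hR : R = x + y + F * (x * y)) (hl : ∀ d ∈ l, 0 < d.top)
    (hA : 0 < A) (hx : A ≤ x) (h : checkAll N F R f A l = true) : ∃ T ≤ x, f T = true := by
  induction l generalizing A with
  | nil => exact ⟨A, hx, h⟩
  | cons d l ih =>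
    rw [checkAll, Bool.and_eq_true] at h
    simp only [List.mem_cons, forall_eq_or_imp] at hl
    exact ih hl.2 hl.1 (not_of_check h.1 hN hR hA hx) h.2

/-- There are no `x, y, z` with the given elementary symmetric polynomials, by reduction
modulo `l`. -/
def cubicCheck (s t u : ℤ) (l : ℕ) : Bool := CoeffList.noRootMod l [-u, t, -s, 1]

end FactorFree

/-! ### Reduction to two prime factors -/

/-- The factors 1 modulo `F` of a product of three large ones. -/
theorem not_of_cubicCheck {F R T x y z l : ℕ}
    (hR : R = x + y + z + F * (x * y + x * z + y * z + F * (x * y * z))) (hF : 0 < F) (hT : 0 < T)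
    (hx : T ≤ x) (hxy : x ≤ y) (hyz : y ≤ z) (h : 3 * (R / F / F / T) < F)
    (hc : FactorFree.cubicCheck (R % F : ℕ) (R / F % F : ℕ) (R / F / F : ℕ) l = true) : False := by
  have h1 : x * y * z ≤ R / F / F := by
    rw [Nat.le_div_iff_mul_le hF, Nat.le_div_iff_mul_le hF, hR]
    calc x * y * z * F * F = F * (F * (x * y * z)) := by ring
      _ ≤ F * (x * y + x * z + y * z + F * (x * y * z)) :=
        Nat.mul_le_mul_left _ (Nat.le_add_left _ _)
      _ ≤ _ := Nat.le_add_left _ _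
  have h2 : y * z ≤ R / F / F / T := by
    rw [Nat.le_div_iff_mul_le hT]
    refine le_trans ?_ h1
    calc y * z * T ≤ y * z * x := Nat.mul_le_mul_left _ hx
      _ = x * y * z := by ring
  have h3 : x * y + x * z + y * z < F := by
    have h4 : x * y ≤ z * y := Nat.mul_le_mul_right _ (hxy.trans hyz)
    have h5 : x * z ≤ y * z := Nat.mul_le_mul_right _ hxy
    nlinarith
  have h4 : x + y + z < F := by
    have hx0 : 1 ≤ x := hT.trans_le hx
    have h5 : x ≤ x * y := Nat.le_mul_of_pos_right _ (by omega)
    have h6 : z ≤ x * z := Nat.le_mul_of_pos_left _ hx0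
    have h7 : y ≤ y * z := Nat.le_mul_of_pos_right _ (by omega)
    omega
  -- The three symmetric polynomials are read off as base F digits, as the first two are below F. By
  -- Vieta, x is then a root of the cubic.
  have e1 : R % F = x + y + z := by
    rw [hR, Nat.add_mul_mod_self_left, Nat.mod_eq_of_lt h4]
  have e2 : R / F = x * y + x * z + y * z + F * (x * y * z) := by
    rw [hR, Nat.add_mul_div_left _ _ hF, Nat.div_eq_of_lt h4, zero_add]
  have e3 : R / F % F = x * y + x * z + y * z := by
    rw [e2, Nat.add_mul_mod_self_left, Nat.mod_eq_of_lt h3]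
  have e4 : R / F / F = x * y * z := by
    rw [e2, Nat.add_mul_div_left _ _ hF, Nat.div_eq_of_lt h3, zero_add]
  refine CoeffList.eval_ne_zero_of_noRootMod hc x ?_
  rw [e1, e3, e4]
  simp only [CoeffList.eval]
  push_cast
  ring

/-- A number all of whose prime factors are 1 modulo a large number `F` is prime or a product of
two large primes, if it has no small factors. -/
theorem exists_prime_mul_prime {N a l : ℕ} {c : PrimeProduct} {L : List FactorFree} {f : ℕ → ℕ → Bool}
    (hN : 1 < N) (hp : ¬ N.Prime) (hc : c.Sound) (h1 : c.modOneCheck N a = true)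
    (hL : ∀ d ∈ L, 0 < d.top)
    (h2 : forced (fun F => forced (fun R => FactorFree.checkAll N F R (fun T =>
      Nat.blt 0 T && Nat.blt (3 * (R / F / F / T)) F &&
        FactorFree.cubicCheck (R % F : ℕ) (R / F % F : ℕ) (R / F / F : ℕ) l && f F T) 1 L)
        ((N - 1) / F)) c.value = true) :
    ∃ p q T : ℕ, p.Prime ∧ q.Prime ∧ N = p * q ∧ p ≤ q ∧ f c.value T = true ∧ T * c.value ≤ p := by
  have hF := hc.value_pos
  obtain ⟨⟨R, hR⟩, hp'⟩ := PrimeProduct.value_dvd_of_modOneCheck hc (zero_lt_one.trans hN) h1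
  obtain ⟨x, y, hx, hxy, hpx, e⟩ := exists_eq_mul_of_not_prime hN hF hp hp'
  have hR' : R = x + y + c.value * (x * y) := by
    refine Nat.eq_of_mul_eq_mul_left hF ?_
    rw [← hR, Nat.sub_eq_iff_eq_add hN.le, e]
    ring
  rw [forced_eq, forced_eq, hR, Nat.mul_div_cancel_left _ hF] at h2
  obtain ⟨T, hT, h⟩ := FactorFree.exists_le_of_checkAll e hR' hL one_pos hx h2
  simp only [Bool.and_eq_true, Nat.blt_eq] at h
  refine ⟨1 + x * c.value, 1 + y * c.value, T,
    hpx ▸ Nat.minFac_prime hN.ne', ?_, e, ?_, h.2, ?_⟩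
  · by_contra hy
    have hy1 : 1 < 1 + y * c.value := by
      have := Nat.mul_pos (hx.trans_le hxy) hF
      omega
    obtain ⟨y₁, y₂, h3, h4, hp1, e'⟩ := exists_eq_mul_of_not_prime hy1 hF hy
      fun p hp hd => hp' p hp (hd.trans ⟨_, by rw [e, mul_comm]⟩)
    have ey : y = y₁ + y₂ + c.value * (y₁ * y₂) := by
      refine Nat.eq_of_mul_eq_mul_left hF ?_
      have : 1 + c.value * y = 1 + c.value * (y₁ + y₂ + c.value * (y₁ * y₂)) := by
        rw [mul_comm c.value y, e']; ring
      omega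
    -- 1 + x F is the least prime factor of N, so the lower bound T for x applies to all three
    -- cofactors.
    have h5 : x ≤ y₁ := by
      have h6 := Nat.minFac_le_of_dvd (hp1 ▸ (Nat.minFac_prime hy1.ne').two_le : 2 ≤ 1 + y₁ * c.value)
        (⟨(1 + x * c.value) * (1 + y₂ * c.value), by rw [e, e']; ring⟩ : 1 + y₁ * c.value ∣ N)
      rw [← hpx] at h6
      exact Nat.le_of_mul_le_mul_right (by omega) hF
    exact not_of_cubicCheck (x := x) (y := y₁) (z := y₂) (by rw [hR', ey]; ring) hF h.1.1.1 hT h5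
      h4 h.1.1.2 h.1.2
  · have := Nat.mul_le_mul_right c.value hxy
    omega
  · have := Nat.mul_le_mul_right c.value hT
    omega

/-! ### Jacobi sums of order 8 and the curve y² = x⁵ + x -/

section JacobiSums

variable {F : Type} [Field F] [Fintype F] [DecidableEq F]

/-- `J(χ, φ) = χ(-1) J(χ, (χφ)⁻¹)`. -/
theorem jacobiSum_eq_mul_jacobiSum_inv_mul (χ φ : MulChar F ℂ) :
    jacobiSum χ φ = χ (-1) * jacobiSum χ (χ * φ)⁻¹ := by
  have h0 : ∀ α β : MulChar F ℂ, jacobiSum α β = ∑ x ∈ Finset.univ.erase 1, α x * β (1 - x) := by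
    intro α β
    rw [jacobiSum, ← Finset.add_sum_erase _ _ (Finset.mem_univ (1 : F)), sub_self,
      MulChar.map_zero, mul_zero, zero_add]
  rw [h0, h0, Finset.mul_sum]
  -- The substitution x ↦ x / (x - 1) is an involution of the field without 1, and 1 - x / (x - 1) =
  -- 1 / (1 - x).
  refine Finset.sum_nbij' (fun x => x / (x - 1)) (fun x => x / (x - 1)) ?_ ?_ ?_ ?_ ?_
  · intro x hx
    simp only [Finset.mem_erase, Finset.mem_univ, and_true] at hx ⊢
    have : x - 1 ≠ 0 := sub_ne_zero.2 hx
    rw [Ne, div_eq_one_iff_eq this]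
    intro h
    exact one_ne_zero (by linear_combination h)
  · intro x hx
    simp only [Finset.mem_erase, Finset.mem_univ, and_true] at hx ⊢
    have : x - 1 ≠ 0 := sub_ne_zero.2 hx
    rw [Ne, div_eq_one_iff_eq this]
    intro h
    exact one_ne_zero (by linear_combination h)
  · intro x hx
    simp only [Finset.mem_erase, Finset.mem_univ, and_true] at hx
    have : x - 1 ≠ 0 := sub_ne_zero.2 hx
    field_simp
    ring_nf
    try simp
  · intro x hx
    simp only [Finset.mem_erase, Finset.mem_univ, and_true] at hx
    have : x - 1 ≠ 0 := sub_ne_zero.2 hx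
    field_simp
    ring_nf
    try simp
  · intro x hx
    simp only [Finset.mem_erase, Finset.mem_univ, and_true] at hx
    have h1 : x - 1 ≠ 0 := sub_ne_zero.2 hx
    have h2 : (1 : F) - x ≠ 0 := sub_ne_zero.2 hx.symm
    have e1 : 1 - x / (x - 1) = (1 - x)⁻¹ := by
      refine eq_inv_of_mul_eq_one_left ?_
      field_simp
      ring
    rw [e1, MulChar.inv_apply', inv_inv, MulChar.mul_apply, ← mul_assoc, ← mul_assoc, ← map_mul,
      ← map_mul]
    congr 2
    field_simp
    ring

theorem MulChar.pow_four_eq_quadraticChar {ψ : MulChar F ℂ} (h8 : orderOf ψ = 8) (y : F) :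
    (ψ ^ 4) y = (quadraticChar F y : ℂ) := by
  by_cases hy : y = 0
  · subst hy; simp
  have hsq : ∀ z : F, z ≠ 0 → IsSquare z → (ψ ^ 4) z = 1 := by
    rintro z hz ⟨w, rfl⟩
    have hw : w ≠ 0 := by rintro rfl; simp at hz
    rw [map_mul, ← sq, ← MulChar.pow_apply' _ two_ne_zero, ← pow_mul]
    norm_num
    rw [← h8, pow_orderOf_eq_one, MulChar.one_apply (Ne.isUnit hw)]
  by_cases hs : IsSquare y
  · rw [hsq y hy hs, (quadraticChar_one_iff_isSquare hy).2 hs]; simp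
  · rw [quadraticChar_neg_one_iff_not_isSquare.2 hs]
    -- If ψ ^ 4 were 1 at one nonsquare y, it would be 1 at all, since the product of two nonsquares
    -- is a square; this contradicts the order 8.
    have h1 : (ψ ^ 4) y ≠ 1 := by
      intro h1
      have h2 : ψ ^ 4 = 1 := by
        ext u
        rw [MulChar.one_apply_coe]
        by_cases hu : IsSquare (u : F)
        · exact hsq _ u.ne_zero hu
        · have h3 : IsSquare (y * u) := by
            rw [← quadraticChar_one_iff_isSquare (mul_ne_zero hy u.ne_zero), map_mul,
              quadraticChar_neg_one_iff_not_isSquare.2 hs,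
              quadraticChar_neg_one_iff_not_isSquare.2 hu]
            norm_num
          have := hsq _ (mul_ne_zero hy u.ne_zero) h3
          rwa [map_mul, h1, one_mul] at this
      have := orderOf_dvd_of_pow_eq_one h2
      rw [h8] at this
      norm_num at this
    have h2 : (ψ ^ 4) y * (ψ ^ 4) y = 1 := by
      rw [← map_mul]; exact hsq _ (mul_ne_zero hy hy) ⟨y, rfl⟩
    rcases mul_self_eq_one_iff.1 h2 with h | h
    · exact absurd h h1
    · rw [h]; simp

/-- Summation over squares. -/
theorem sum_comp_sq (hF : ringChar F ≠ 2) (h : F → ℂ) :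
    ∑ y, h (y ^ 2) = ∑ v, h v * (1 + (quadraticChar F v : ℂ)) := by
  rw [← Finset.sum_fiberwise_of_maps_to (t := Finset.univ) (g := fun y : F => y ^ 2)
    (fun _ _ => Finset.mem_univ _)]
  refine Finset.sum_congr rfl fun v _ => ?_
  rw [Finset.sum_congr rfl (g := fun _ => h v) (by intro x hx; simp at hx; rw [hx]),
    Finset.sum_const, nsmul_eq_mul, mul_comm]
  congr 1
  have := quadraticChar_card_sqrts hF v
  rw [add_comm]
  have e : ({x : F | x ^ 2 = v}.toFinset) = Finset.univ.filter fun y : F => y ^ 2 = v := by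
    ext; simp
  rw [e] at this
  exact_mod_cast this

/-- By the reflection formula both sides are χ(-1) J(χ, χ ^ 3), as (χ ^ 5)⁻¹ = χ ^ 3 and (χ ^ 7)⁻¹ =
χ. -/
theorem jacobiSum_pow_three {χ : MulChar F ℂ} (h : χ ^ 8 = 1) :
    jacobiSum (χ ^ 3) (χ ^ 4) = jacobiSum χ (χ ^ 4) := by
  have hu : χ (-1) * χ (-1) = 1 := by rw [← map_mul]; simp
  have h1 : (χ * χ ^ 4)⁻¹ = χ ^ 3 := by
    rw [inv_eq_iff_mul_eq_one, ← pow_succ', ← pow_add, h]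
  have h2 : (χ ^ 3 * χ ^ 4)⁻¹ = χ := by
    rw [inv_eq_iff_mul_eq_one, ← pow_add, ← pow_succ, h]
  rw [jacobiSum_eq_mul_jacobiSum_inv_mul χ, jacobiSum_eq_mul_jacobiSum_inv_mul (χ ^ 3), h1, h2,
    jacobiSum_comm χ, MulChar.pow_apply' _ three_ne_zero]
  linear_combination χ (-1) * jacobiSum (χ ^ 3) χ * hu

/-- The sum that counts the points of `y ^ 2 = x ^ 5 + x`, in terms of Jacobi sums. -/
theorem sum_quadraticChar_quintic {ψ : MulChar F ℂ} (h8 : orderOf ψ = 8) (hF : ringChar F ≠ 2) :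
    ∑ x : F, (quadraticChar F (x * (x ^ 4 + 1)) : ℂ) =
      2 * ψ (-1) * (jacobiSum ψ (ψ ^ 4) + jacobiSum ψ⁻¹ (ψ⁻¹ ^ 4)) := by
  have hη := MulChar.pow_four_eq_quadraticChar h8
  have h1 : ψ ^ 8 = 1 := by rw [← h8, pow_orderOf_eq_one]
  have hi : ψ⁻¹ ^ 8 = 1 := by rw [inv_pow, h1, inv_one]
  have hi4 : ψ⁻¹ ^ 4 = ψ ^ 4 := by
    rw [inv_pow, inv_eq_iff_mul_eq_one, ← pow_add, h1]
  have h7 : ψ ^ 7 = ψ⁻¹ := by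
    rw [eq_inv_iff_mul_eq_one, ← pow_succ, h1]
  have h5 : ψ ^ 5 = ψ⁻¹ ^ 3 := by
    rw [inv_pow, eq_inv_iff_mul_eq_one, ← pow_add, h1]
  have hJ : ∀ χ : MulChar F ℂ, ∑ v, χ v * (ψ ^ 4) (v + 1) = χ (-1) * jacobiSum χ (ψ ^ 4) := by
    intro χ
    rw [jacobiSum, Finset.mul_sum, ← Equiv.sum_comp (Equiv.neg F)]
    refine Finset.sum_congr rfl fun v _ => ?_
    rw [Equiv.neg_apply, ← mul_assoc, ← map_mul, neg_one_mul, neg_add_eq_sub]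
  have hu : ψ (-1) * ψ (-1) = 1 := by rw [← map_mul]; simp
  have hui : ψ⁻¹ (-1) = ψ (-1) := by rw [MulChar.inv_apply']; norm_num
  have e0 : ∀ x : F, (quadraticChar F (x * (x ^ 4 + 1)) : ℂ) =
      ψ ((x ^ 2) ^ 2) * (ψ ^ 4) ((x ^ 2) ^ 2 + 1) := by
    intro x
    rw [map_mul, Int.cast_mul, ← hη, ← hη, MulChar.pow_apply' _ four_ne_zero,
      ← map_pow, ← pow_mul]
  have e1 : ∀ y : F, (1 + (quadraticChar F y : ℂ)) = 1 + (ψ ^ 2) (y ^ 2) := by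
    intro y
    rw [← hη, MulChar.pow_apply' _ four_ne_zero, MulChar.pow_apply' _ two_ne_zero, map_pow,
      ← pow_mul]
  have e2 : ∀ v : F, ψ v * (ψ ^ 4) (v + 1) * (1 + (ψ ^ 2) v) * (1 + (quadraticChar F v : ℂ)) =
      ψ v * (ψ ^ 4) (v + 1) + (ψ ^ 3) v * (ψ ^ 4) (v + 1) + (ψ⁻¹ ^ 3) v * (ψ ^ 4) (v + 1) +
        ψ⁻¹ v * (ψ ^ 4) (v + 1) := by
    intro v
    rw [← hη v, ← h5, ← h7]
    simp only [MulChar.pow_apply' _ two_ne_zero, MulChar.pow_apply' _ three_ne_zero,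
      MulChar.pow_apply' _ four_ne_zero, MulChar.pow_apply' _ (n := 5) (by norm_num),
      MulChar.pow_apply' _ (n := 7) (by norm_num)]
    ring
  simp only [e0]
  -- The summand depends only on x ^ 4. Two passages from squares to all elements introduce (1 + ψ ^
  -- 2) (1 + ψ ^ 4), and expansion gives Jacobi sums of ψ, ψ ^ 3, ψ ^ 5 and ψ ^ 7 with ψ ^ 4.
  rw [sum_comp_sq hF fun v => ψ (v ^ 2) * (ψ ^ 4) (v ^ 2 + 1)]
  simp only [e1]
  rw [sum_comp_sq hF fun v => ψ v * (ψ ^ 4) (v + 1) * (1 + (ψ ^ 2) v)]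
  simp only [e2, Finset.sum_add_distrib, hJ]
  rw [jacobiSum_pow_three h1]
  have := jacobiSum_pow_three hi
  rw [hi4] at this ⊢
  rw [this, hui, MulChar.pow_apply' _ three_ne_zero, MulChar.pow_apply' _ three_ne_zero, hui]
  linear_combination (ψ (-1) * jacobiSum ψ (ψ ^ 4) + ψ (-1) * jacobiSum ψ⁻¹ (ψ ^ 4)) * hu

/-- For an eighth root of unity `z`, the number `z + z ^ 3` is an integer multiple of 2 or of a fixed
square root of `-2`. -/
theorem add_pow_three_of_pow_eight {s z : ℂ} (hs : s ^ 2 = -2) (hz : z ^ 8 = 1) :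
    ∃ a b : ℤ, z + z ^ 3 = 2 * a + b * s := by
  have h : (z - 1) * (z + 1) * (z ^ 2 + 1) * (z ^ 4 + 1) = 0 := by linear_combination hz
  rcases mul_eq_zero.1 h with h | h
  · rcases mul_eq_zero.1 h with h | h
    · rcases mul_eq_zero.1 h with h | h
      · exact ⟨1, 0, by rw [sub_eq_zero.1 h]; norm_num⟩
      · exact ⟨-1, 0, by rw [eq_neg_of_add_eq_zero_left h]; norm_num⟩
    · exact ⟨0, 0, by push_cast; linear_combination z * h⟩
  · have h2 : (z + z ^ 3 - s) * (z + z ^ 3 + s) = 0 := by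
      linear_combination (z ^ 2 + 2) * h - hs
    rcases mul_eq_zero.1 h2 with h | h
    · exact ⟨0, 1, by push_cast; linear_combination h⟩
    · exact ⟨0, -1, by push_cast; linear_combination h⟩

/-- Over a field of order `q`, 1 modulo 8, the sum that counts the points of `y ^ 2 = x ^ 5 + x` is
`4 a` with `q = a ^ 2 + 2 b ^ 2`. -/
theorem exists_sum_quadraticChar_quintic (h : 8 ∣ Fintype.card F - 1) :
    ∃ a b : ℤ, (Fintype.card F : ℤ) = a ^ 2 + 2 * b ^ 2 ∧
      ∑ x : F, quadraticChar F (x * (x ^ 4 + 1)) = 4 * a := by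
  have hF : ringChar F ≠ 2 := by
    intro h2
    have h3 := FiniteField.even_card_of_char_two h2
    have h4 : 1 < Fintype.card F := Fintype.one_lt_card
    omega
  obtain ⟨ψ, h8⟩ := MulChar.exists_mulChar_orderOf F h (Complex.isPrimitiveRoot_exp 8 (by norm_num))
  have h1 : ψ ^ 8 = 1 := by rw [← h8, pow_orderOf_eq_one]
  have hi4 : ψ⁻¹ ^ 4 = (ψ ^ 4)⁻¹ := inv_pow _ _
  have hT := sum_quadraticChar_quintic h8 hF
  set s : ℂ := Real.sqrt 2 * Complex.I with hs
  have hs2 : s ^ 2 = -2 := by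
    rw [hs, mul_pow, Complex.I_sq, ← Complex.ofReal_pow, Real.sq_sqrt (by norm_num)]
    push_cast; ring
  have hval : ∀ (x : F), ∃ a b : ℤ, ψ x + (ψ ^ 3) x = 2 * a + b * s := by
    intro x
    by_cases hx : x = 0
    · exact ⟨0, 0, by rw [hx, MulChar.map_zero, MulChar.map_zero]; simp⟩
    · rw [MulChar.pow_apply' _ three_ne_zero]
      refine add_pow_three_of_pow_eight hs2 ?_
      rw [← MulChar.pow_apply' _ (by norm_num), h1, MulChar.one_apply (Ne.isUnit hx)]
  choose α β hαβ using hval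
  set J := jacobiSum ψ (ψ ^ 4) with hJ
  -- Since J(ψ, ψ ^ 4) = J(ψ ^ 3, ψ ^ 4), the values of ψ enter 2 J only through ψ + ψ ^ 3, which
  -- lies in 2ℤ + ℤ√-2.
  obtain ⟨A, B, hAB⟩ : ∃ A B : ℤ, 2 * J = 2 * A + B * s := by
    refine ⟨∑ x, α x * quadraticChar F (1 - x), ∑ x, β x * quadraticChar F (1 - x), ?_⟩
    calc 2 * J = jacobiSum ψ (ψ ^ 4) + jacobiSum (ψ ^ 3) (ψ ^ 4) := by
          rw [jacobiSum_pow_three h1]; ring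
      _ = ∑ x, (2 * α x + β x * s) * (quadraticChar F (1 - x) : ℂ) := by
          rw [jacobiSum, jacobiSum, ← Finset.sum_add_distrib]
          refine Finset.sum_congr rfl fun x _ => ?_
          rw [← add_mul, hαβ, MulChar.pow_four_eq_quadraticChar h8]
      _ = _ := by
          push_cast
          rw [Finset.mul_sum, Finset.sum_mul, ← Finset.sum_add_distrib]
          exact Finset.sum_congr rfl fun x _ => by ring
  have hconj : jacobiSum ψ⁻¹ (ψ⁻¹ ^ 4) = star J := by
    rw [hJ, jacobiSum, jacobiSum, star_sum, hi4]
    refine Finset.sum_congr rfl fun x _ => ?_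
    rw [star_mul', MulChar.star_apply', MulChar.star_apply']
  have hss : star s = -s := by simp [hs]
  have hJ2 : 2 * star J = 2 * A - B * s := by
    have := congrArg star hAB
    simp only [star_mul', star_add, hss] at this
    simpa [sub_eq_add_neg] using this
  have hpow : ∀ k : ℕ, 0 < k → k < 8 → ψ ^ k ≠ 1 := fun k hk hk8 hk1 => by
    have := Nat.le_of_dvd hk (orderOf_dvd_of_pow_eq_one hk1)
    omega
  have hN : J * star J = Fintype.card F := by
    rw [← hconj, hi4]
    refine jacobiSum_mul_jacobiSum_inv ?_ (by simpa using hpow 1) (hpow 4 (by norm_num) (by norm_num))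
      (by rw [← pow_succ']; exact hpow 5 (by norm_num) (by norm_num))
    rw [ringChar.eq_zero]
    have : CharP F (ringChar F) := inferInstance
    exact (CharP.ringChar_ne_zero_of_finite F).symm
  have hq : 4 * (Fintype.card F : ℤ) = 4 * A ^ 2 + 2 * B ^ 2 := by
    have : (4 * (Fintype.card F : ℂ)) = 4 * A ^ 2 + 2 * B ^ 2 := by
      rw [← hN]
      linear_combination (2 * star J) * hAB + (2 * A + B * s) * hJ2 - B ^ 2 * hs2
    exact_mod_cast this
  -- J times its conjugate is q, so 4 q = 4 A ^ 2 + 2 B ^ 2, which makes B even and J = A + b √-2.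
  obtain ⟨b, rfl⟩ : (2 : ℤ) ∣ B := by
    have : (2 : ℤ) ∣ B ^ 2 := ⟨(Fintype.card F : ℤ) - A ^ 2, by linarith⟩
    exact Int.prime_two.dvd_of_dvd_pow this
  obtain ⟨ε, hε, hε2⟩ : ∃ ε : ℤ, (ψ (-1) : ℂ) = ε ∧ ε ^ 2 = 1 := by
    have hu : ψ (-1) * ψ (-1) = 1 := by rw [← map_mul]; simp
    rcases mul_self_eq_one_iff.1 hu with h | h
    · exact ⟨1, by rw [h]; simp, by norm_num⟩
    · exact ⟨-1, by rw [h]; simp, by norm_num⟩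
  refine ⟨ε * A, b, ?_, ?_⟩
  · rw [mul_pow, hε2]; linarith
  · have : ((∑ x : F, quadraticChar F (x * (x ^ 4 + 1)) : ℤ) : ℂ) = (4 * (ε * A) : ℤ) := by
      rw [Int.cast_sum, hT, hconj, hε]
      push_cast
      linear_combination (ε : ℂ) * hAB + ε * hJ2
    exact_mod_cast this

end JacobiSums

/-! ### From the quintic to the cubic -/

section PointCount

variable {F : Type} [Field F] [Fintype F] [DecidableEq F]

theorem sum_comp_add_inv (hF : ringChar F ≠ 2) (g : F → ℤ) :
    ∑ x ∈ Finset.univ.erase (0 : F), g (x + x⁻¹) = ∑ u, g u * (1 + quadraticChar F (u ^ 2 - 4)) := by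
  have h2 : (2 : F) ≠ 0 := Ring.two_ne_zero hF
  rw [← Finset.sum_fiberwise (Finset.univ.erase (0 : F)) (fun x => x + x⁻¹)]
  refine Finset.sum_congr rfl fun u _ => ?_
  rw [Finset.sum_congr rfl (fun x hx => by rw [(Finset.mem_filter.1 hx).2] : ∀ x ∈ Finset.filter
    (fun x => x + x⁻¹ = u) (Finset.univ.erase (0 : F)), g (x + x⁻¹) = g u), Finset.sum_const,
    nsmul_eq_mul, mul_comm, add_comm, ← quadraticChar_card_sqrts hF]
  congr 2
  -- The solutions of x + 1 / x = u are the roots of X² - u X + 1, and 2 x - u runs over the square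
  -- roots of its discriminant.
  refine Finset.card_nbij' (fun x => 2 * x - u) (fun y => (y + u) / 2) ?_ ?_ ?_ ?_
  · intro x hx
    simp only [Finset.coe_filter, Finset.mem_erase, Finset.mem_univ, and_true, Set.mem_ofPred_eq]
      at hx
    obtain ⟨h0, rfl⟩ := hx
    simp only [Set.coe_toFinset, Set.mem_ofPred_eq]
    field_simp
    ring
  · intro y hy
    simp only [Set.coe_toFinset, Set.mem_ofPred_eq] at hy
    have h3 : (y + u) / 2 * ((u - y) / 2) = 1 := by
      field_simp
      linear_combination -hy
    have h4 : (y + u) / 2 ≠ 0 := left_ne_zero_of_mul_eq_one h3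
    simp only [Finset.coe_filter, Finset.mem_erase, Finset.mem_univ, and_true, Set.mem_ofPred_eq]
    refine ⟨h4, ?_⟩
    rw [inv_eq_of_mul_eq_one_right h3]
    field_simp
    ring
  · intro x _
    field_simp
    ring
  · intro y _
    field_simp
    ring

theorem quadraticChar_mul_sq {a : F} (b : F) (ha : a ≠ 0) :
    quadraticChar F (a ^ 2 * b) = quadraticChar F b := by
  rw [map_mul, quadraticChar_sq_one' ha, one_mul]

/-- With u = x + 1 / x, the quintic x (x ^ 4 + 1) equals (u + 2) (u ^ 2 - 2) up to a square factor.
The two halves of the factor 1 + χ(u ^ 2 - 4) contribute equal sums up to corrections that cancel,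
and u = x - 2 gives the cubic. That -1 and 2 are squares is used throughout. -/
theorem sum_quadraticChar_cubic (h : 8 ∣ Fintype.card F - 1) :
    ∑ x : F, quadraticChar F (x * (x ^ 4 + 1)) =
      2 * ∑ x : F, quadraticChar F (x ^ 3 - 4 * x ^ 2 + 2 * x) := by
  have hc : Fintype.card F % 8 = 1 := by
    have h4 : 1 < Fintype.card F := Fintype.one_lt_card
    omega
  have hF : ringChar F ≠ 2 := by
    intro h2
    have h3 := FiniteField.even_card_of_char_two h2
    omega
  have h2 : (2 : F) ≠ 0 := Ring.two_ne_zero hF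
  have e1 : quadraticChar F (-1) = 1 := by
    rw [quadraticChar_one_iff_isSquare (neg_ne_zero.2 one_ne_zero),
      FiniteField.isSquare_neg_one_iff]
    omega
  have e2 : quadraticChar F 2 = 1 := by
    rw [quadraticChar_one_iff_isSquare h2, FiniteField.isSquare_two_iff]
    omega
  set χ := quadraticChar F with hχ
  have hneg : ∀ a : F, χ (-a) = χ a := fun a => by rw [← neg_one_mul, map_mul, e1, one_mul]
  let g : F → ℤ := fun u => χ ((u + 2) * (u ^ 2 - 2))
  have s1 : ∑ x : F, χ (x * (x ^ 4 + 1)) =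
      1 + ∑ x ∈ Finset.univ.erase (0 : F), g (x + x⁻¹) := by
    rw [← Finset.add_sum_erase _ _ (Finset.mem_univ (0 : F)), zero_mul, MulChar.map_zero, zero_add]
    -- At x = -1 the square factor degenerates: the quintic contributes χ(-2) = 1 there and g
    -- contributes 0.
    have hm : (-1 : F) ∈ Finset.univ.erase (0 : F) := by simp
    rw [← Finset.add_sum_erase _ _ hm, ← Finset.add_sum_erase _ (fun x => g (x + x⁻¹)) hm]
    have e3 : χ (-1 * ((-1) ^ 4 + 1)) = 1 := by
      rw [show (-1 : F) * ((-1) ^ 4 + 1) = -2 by norm_num, hneg, e2]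
    have e4 : g (-1 + (-1)⁻¹) = 0 := by
      simp only [g]
      rw [show (-1 + (-1 : F)⁻¹ + 2) = 0 by rw [inv_neg, inv_one]; ring, zero_mul]
      exact MulChar.map_zero _
    rw [e3, e4, zero_add]
    congr 1
    refine Finset.sum_congr rfl fun x hx => ?_
    simp only [Finset.mem_erase, Finset.mem_univ, and_true] at hx
    obtain ⟨hx1, hx0⟩ := hx
    have hx2 : x + 1 ≠ 0 := fun h => hx1 (eq_neg_of_add_eq_zero_left h)
    simp only [g]
    rw [show (x + x⁻¹ + 2) * ((x + x⁻¹) ^ 2 - 2) = ((x + 1) / x ^ 2) ^ 2 * (x * (x ^ 4 + 1)) by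
      field_simp; ring]
    rw [hχ, quadraticChar_mul_sq _ (div_ne_zero hx2 (pow_ne_zero _ hx0))]
  -- Multiplication by u ^ 2 - 4 turns u + 2 into u - 2 up to the square of u + 2, and u ↦ -u leads
  -- back to g. The term at u = -2 is the correction.
  have s2 : ∑ u : F, g u * χ (u ^ 2 - 4) = ∑ u : F, g u - 1 := by
    have s3 : ∑ u : F, g u = ∑ u : F, χ ((u - 2) * (u ^ 2 - 2)) := by
      refine Fintype.sum_equiv (Equiv.neg F) _ _ fun u => ?_
      rw [Equiv.neg_apply, ← hneg]
      simp only [g]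
      congr 1
      ring
    rw [s3, eq_sub_iff_add_eq, ← Finset.add_sum_erase _ _ (Finset.mem_univ (-2 : F)),
      ← Finset.add_sum_erase _ (fun u : F => χ ((u - 2) * (u ^ 2 - 2))) (Finset.mem_univ (-2 : F))]
    have e3 : χ ((-2 - 2) * ((-2) ^ 2 - 2)) = 1 := by
      rw [show ((-2 : F) - 2) * ((-2) ^ 2 - 2) = -(2 ^ 2 * 2) by norm_num, hneg, hχ,
        quadraticChar_mul_sq _ h2, e2]
    rw [e3, show ((-2 : F) ^ 2 - 4) = 0 by norm_num, MulChar.map_zero, mul_zero, zero_add, add_comm]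
    congr 1
    refine Finset.sum_congr rfl fun u hu => ?_
    simp only [Finset.mem_erase, Finset.mem_univ, and_true] at hu
    have hu2 : u + 2 ≠ 0 := fun h => hu (eq_neg_of_add_eq_zero_left h)
    simp only [g]
    rw [← map_mul, show (u + 2) * (u ^ 2 - 2) * (u ^ 2 - 4) =
      (u + 2) ^ 2 * ((u - 2) * (u ^ 2 - 2)) by ring, hχ, quadraticChar_mul_sq _ hu2]
  have s4 : ∑ u : F, g u = ∑ x : F, χ (x ^ 3 - 4 * x ^ 2 + 2 * x) := by
    refine Fintype.sum_equiv (Equiv.addRight 2) _ _ fun u => ?_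
    simp only [g, Equiv.coe_addRight]
    congr 1
    ring
  rw [s1, sum_comp_add_inv hF, ← s4]
  simp only [mul_add, mul_one, Finset.sum_add_distrib]
  rw [s2]
  ring

end PointCount

/-! ### The elliptic curve and its number of points -/

/-- The elliptic curve `y² = x³ - 4x² + 2x`, which has complex multiplication by `ℤ[√-2]`. -/
def cmCurve (F : Type) [CommRing F] : WeierstrassCurve.Affine F := ⟨0, -4, 0, 2, 0⟩

namespace cmCurve

theorem Δ_eq (F : Type) [CommRing F] : (cmCurve F).Δ = 2 ^ 9 := by
  simp only [cmCurve, WeierstrassCurve.Δ, WeierstrassCurve.b₂, WeierstrassCurve.b₄,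
    WeierstrassCurve.b₆, WeierstrassCurve.b₈]
  ring

theorem equation_iff {F : Type} [CommRing F] (x y : F) :
    (cmCurve F).Equation x y ↔ y ^ 2 = x ^ 3 - 4 * x ^ 2 + 2 * x := by
  rw [WeierstrassCurve.Affine.equation_iff]
  simp only [cmCurve]
  constructor <;> intro h <;> linear_combination h

theorem nonsingular_iff {F : Type} [Field F] (h2 : (2 : F) ≠ 0) (x y : F) :
    (cmCurve F).Nonsingular x y ↔ y ^ 2 = x ^ 3 - 4 * x ^ 2 + 2 * x := by
  rw [← WeierstrassCurve.Affine.equation_iff_nonsingular_of_Δ_ne_zero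
    (by rw [Δ_eq]; exact pow_ne_zero _ h2), equation_iff]

variable {F : Type} [Field F] [Fintype F] [DecidableEq F]

theorem card_point (hF : ringChar F ≠ 2) : (Nat.card (cmCurve F).Point : ℤ) =
    1 + Fintype.card F + ∑ x : F, quadraticChar F (x ^ 3 - 4 * x ^ 2 + 2 * x) := by
  have h2 : (2 : F) ≠ 0 := Ring.two_ne_zero hF
  have e : {xy : F × F // (cmCurve F).Nonsingular xy.1 xy.2} ≃
      (x : F) × {y : F // y ^ 2 = x ^ 3 - 4 * x ^ 2 + 2 * x} :=
    (Equiv.subtypeEquivRight fun xy => nonsingular_iff h2 _ _).trans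
      (Equiv.subtypeProdEquivSigmaSubtype fun x y => y ^ 2 = x ^ 3 - 4 * x ^ 2 + 2 * x)
  rw [Nat.card_congr (WeierstrassCurve.Affine.nonsingularPointEquiv (cmCurve F))]
  change (Nat.card (Option _) : ℤ) = _
  rw [Finite.card_option, Nat.card_congr e, Nat.card_sigma]
  push_cast
  have h3 : ∀ x : F, (Nat.card {y : F // y ^ 2 = x ^ 3 - 4 * x ^ 2 + 2 * x} : ℤ) =
      quadraticChar F (x ^ 3 - 4 * x ^ 2 + 2 * x) + 1 := fun x => by
    rw [← quadraticChar_card_sqrts hF, ← Set.ncard_eq_toFinset_card']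
    rfl
  rw [Finset.sum_congr rfl fun x _ => h3 x, Finset.sum_add_distrib]
  simp only [Finset.sum_const, Finset.card_univ, nsmul_eq_mul, mul_one]
  ring

/-- The number of points of `cmCurve`, in terms of a representation of the size of the field. -/
theorem exists_card_point (h : 8 ∣ Fintype.card F - 1) :
    ∃ a b : ℤ, (Fintype.card F : ℤ) = a ^ 2 + 2 * b ^ 2 ∧
      (Nat.card (cmCurve F).Point : ℤ) = (a - 1) ^ 2 + 2 * b ^ 2 := by
  have hF : ringChar F ≠ 2 := by
    intro h2
    have h3 := FiniteField.even_card_of_char_two h2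
    have h4 : 1 < Fintype.card F := Fintype.one_lt_card
    omega
  obtain ⟨a, b, hab, hs⟩ := exists_sum_quadraticChar_quintic h
  -- The character sum of the cubic is 2 a, and 1 + a ^ 2 + 2 b ^ 2 + 2 a = (-a - 1) ^ 2 + 2 b ^ 2.
  refine ⟨-a, b, by rw [hab]; ring, ?_⟩
  rw [sum_quadraticChar_cubic h] at hs
  rw [card_point hF, show ∑ x : F, quadraticChar F (x ^ 3 - 4 * x ^ 2 + 2 * x) = 2 * a by linarith,
    hab]
  ring

end cmCurve

/-! ### Points modulo N and their orders -/

/-- Jacobian coordinates: the point `(x / z ^ 2, y / z ^ 3)`. -/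
structure JacobianCoords : Type where
  /-- The first coordinate. -/
  x : ℕ
  /-- The second coordinate. -/
  y : ℕ
  /-- The third coordinate. -/
  z : ℕ

namespace JacobianCoords

/-- `forced f T` is `f T`, arranged so that the kernel evaluates the coordinates of `T` first. -/
def forced {α : Type} (f : JacobianCoords → α) : JacobianCoords → α
  | ⟨x, y, z⟩ => _root_.forced (fun x => _root_.forced (fun y => _root_.forced
    (fun z => f ⟨x, y, z⟩) z) y) x

theorem forced_eq {α : Type} (f : JacobianCoords → α) (T : JacobianCoords) : forced f T = f T := by
  simp only [forced, _root_.forced_eq]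

/-- Doubling modulo `N` on the curve `y² = x³ - 4x² + 2x`. -/
def double (N : ℕ) (T : JacobianCoords) : JacobianCoords :=
  _root_.forced (fun w => _root_.forced (fun s => _root_.forced (fun t => _root_.forced (fun m =>
    _root_.forced (fun z => _root_.forced (fun x =>
      ⟨x, (m * (t + (N - x)) + 8 * (N - s * s % N)) % N, z⟩)
      ((m * m + 4 * (z * z) + 2 * (N - t)) % N))
      (2 * T.y * T.z % N))
      ((3 * (T.x * T.x) + 2 * (w * w) + 8 * T.x * (N - w)) % N))
      (4 * T.x * s % N))
      (T.y * T.y % N))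
      (T.z * T.z % N)

/-- Addition modulo `N` on the curve `y² = x³ - 4x² + 2x`, for points with different abscissas. -/
def add (N : ℕ) (T U : JacobianCoords) : JacobianCoords :=
  _root_.forced (fun v => _root_.forced (fun w => _root_.forced (fun a => _root_.forced (fun b =>
    _root_.forced (fun c => _root_.forced (fun h => _root_.forced (fun r => _root_.forced (fun k =>
    _root_.forced (fun z => _root_.forced (fun t => _root_.forced (fun x =>
      ⟨x, (r * (t + (N - x)) + c * (N - k * h % N)) % N, z⟩)
      ((r * r + 4 * (z * z) + (a + b) * (N - k)) % N))
      (a * k % N))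
      (T.z * U.z * h % N))
      (h * h % N))
      ((U.y * (T.z * v) + (N - c)) % N))
      ((b + (N - a)) % N))
      (T.y * (U.z * w) % N))
      (U.x * v % N))
      (T.x * w % N))
      (U.z * U.z % N))
      (T.z * T.z % N)

/-- Computes `2 ^ n * T + e * S` for `n ≤ 2 ^ d` and `e < 2 ^ n`. -/
def mulAux (N : ℕ) (S : JacobianCoords) : ℕ → ℕ → ℕ → JacobianCoords → JacobianCoords
  | 0, n, e, T =>
    bif n == 0 then T else forced (fun U => bif e == 0 then U else add N U S) (double N T)
  | d + 1, n, e, T => _root_.forced (fun k => _root_.forced (fun l => _root_.forced (fun e₀ =>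
    _root_.forced (fun e₁ => forced (mulAux N S d k e₀) (mulAux N S d l e₁ T))
      (e / 2 ^ k)) (e % 2 ^ k)) (n - k)) (n / 2)

/-- Computes `m * T` for positive `m`. -/
def mul (N m : ℕ) (T : JacobianCoords) : JacobianCoords :=
  _root_.forced (fun l => mulAux N T (Nat.log2 l + 1) l (m - 2 ^ l) T) (Nat.log2 m)

section Soundness

variable {F : Type} [Field F]

/-- The coordinates describe the point, unless `z` vanishes. -/
def Represents (T : JacobianCoords) (P : (cmCurve F).Point) : Prop :=
  (T.z : F) ≠ 0 → ∃ (x y : F) (h : (cmCurve F).Nonsingular x y), P = .some x y h ∧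
    x * (T.z : F) ^ 2 = T.x ∧ y * (T.z : F) ^ 3 = T.y

variable {N : ℕ}

theorem cast_mod (hN : (N : F) = 0) (a : ℕ) : ((a % N : ℕ) : F) = a := by
  conv_rhs => rw [← Nat.div_add_mod a N]
  simp [hN]

theorem cast_sub_mod (h0 : 0 < N) (hN : (N : F) = 0) (a : ℕ) : ((N - a % N : ℕ) : F) = -a := by
  rw [Nat.cast_sub (Nat.mod_lt _ h0).le, hN, cast_mod hN, zero_sub]

theorem forced_eq'' {α : Type} : @forced α = fun f T => f T := by
  funext f T; exact forced_eq f T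

variable [DecidableEq F]

/-- The new third coordinate is 2 y z up to normalization. Where it does not vanish, the old one
does not either and the point is not 2-torsion, so the tangent formula applies; elsewhere nothing is
claimed. Degenerate steps therefore need no treatment, and a final gcd with N suffices. -/
theorem Represents.double (h0 : 0 < N) (hN : (N : F) = 0) {T : JacobianCoords}
    {P : (cmCurve F).Point} (h : Represents T P) : Represents (double N T) (P + P) := by
  obtain ⟨X, Y, Z⟩ := T
  intro hz
  simp only [JacobianCoords.double, PrimeProduct.forced_eq', cast_mod hN] at hz
  push_cast at hz
  have hZ : (Z : F) ≠ 0 := right_ne_zero_of_mul hz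
  obtain ⟨x, y, hxy, rfl, hx, hy⟩ := h hZ
  dsimp only at hx hy
  have h2y : 2 * y ≠ 0 := by
    have := left_ne_zero_of_mul hz
    rw [← hy] at this
    intro h'
    exact this (by linear_combination (Z : F) ^ 3 * h')
  have hne : y ≠ (cmCurve F).negY x y := by
    simp only [WeierstrassCurve.Affine.negY, cmCurve]
    intro h'
    exact h2y (by linear_combination h')
  rw [WeierstrassCurve.Affine.Point.add_some (fun h' => hne h'.2)]
  refine ⟨_, _, _, rfl, ?_⟩
  rw [WeierstrassCurve.Affine.slope_of_Y_ne rfl hne]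
  simp only [JacobianCoords.double, PrimeProduct.forced_eq', cast_mod hN]
  push_cast [cast_sub_mod h0 hN, cast_mod hN]
  simp only [WeierstrassCurve.Affine.addX, WeierstrassCurve.Affine.addY,
    WeierstrassCurve.Affine.negAddY, WeierstrassCurve.Affine.negY, cmCurve]
  simp only [← hx, ← hy]
  have e : y - (-y - 0 * x - 0) = 2 * y := by ring
  rw [e]
  have hy0 : y ≠ 0 := right_ne_zero_of_mul h2y
  have h20 : (2 : F) ≠ 0 := left_ne_zero_of_mul h2y
  constructor
  · field_simp
    ring
  · field_simp
    ring

/-- The new third coordinate contains the difference of the abscissas, so its nonvanishing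
guarantees the generic chord formula. -/
theorem Represents.add (h0 : 0 < N) (hN : (N : F) = 0) {T U : JacobianCoords}
    {P Q : (cmCurve F).Point} (h : Represents T P) (h' : Represents U Q) :
    Represents (add N T U) (P + Q) := by
  obtain ⟨X, Y, Z⟩ := T
  obtain ⟨X', Y', Z'⟩ := U
  intro hz
  simp only [JacobianCoords.add, PrimeProduct.forced_eq', cast_mod hN] at hz
  push_cast [cast_sub_mod h0 hN, cast_mod hN] at hz
  have hZ : (Z : F) ≠ 0 := left_ne_zero_of_mul (left_ne_zero_of_mul hz)
  have hZ' : (Z' : F) ≠ 0 := right_ne_zero_of_mul (left_ne_zero_of_mul hz)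
  obtain ⟨x, y, hxy, rfl, hx, hy⟩ := h hZ
  obtain ⟨x', y', hxy', rfl, hx', hy'⟩ := h' hZ'
  dsimp only at hx hy hx' hy'
  have hd : x - x' ≠ 0 := by
    have := right_ne_zero_of_mul hz
    rw [← hx, ← hx'] at this
    intro h'
    exact this (by linear_combination -(Z : F) ^ 2 * (Z' : F) ^ 2 * h')
  have hne : x ≠ x' := sub_ne_zero.1 hd
  rw [WeierstrassCurve.Affine.Point.add_some (fun h' => hne h'.1)]
  refine ⟨_, _, _, rfl, ?_⟩
  rw [WeierstrassCurve.Affine.slope_of_X_ne hne]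
  simp only [JacobianCoords.add, PrimeProduct.forced_eq', cast_mod hN]
  push_cast [cast_sub_mod h0 hN, cast_mod hN]
  simp only [WeierstrassCurve.Affine.addX, WeierstrassCurve.Affine.addY,
    WeierstrassCurve.Affine.negAddY, WeierstrassCurve.Affine.negY, cmCurve]
  simp only [← hx, ← hy, ← hx', ← hy']
  constructor
  · field_simp
    ring
  · field_simp
    ring

theorem Represents.mulAux (h0 : 0 < N) (hN : (N : F) = 0) {S : JacobianCoords}
    {Q : (cmCurve F).Point} (hS : Represents S Q) (d n e : ℕ) (hn : n ≤ 2 ^ d) (he : e < 2 ^ n)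
    {T : JacobianCoords} {P : (cmCurve F).Point} (hT : Represents T P) :
    Represents (mulAux N S d n e T) (2 ^ n • P + e • Q) := by
  induction d generalizing n e T P with
  | zero =>
    simp only [JacobianCoords.mulAux, forced_eq'']
    have : n = 0 ∨ n = 1 := by rw [pow_zero] at hn; omega
    rcases this with rfl | rfl
    · have : e = 0 := by simpa using he
      subst this
      simpa using hT
    · have : e = 0 ∨ e = 1 := by rw [pow_one] at he; omega
      rcases this with rfl | rfl
      · simpa [two_nsmul] using hT.double h0 hN
      · simpa [two_nsmul] using (hT.double h0 hN).add h0 hN hS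
  | succ d ih =>
    simp only [JacobianCoords.mulAux, forced_eq'', PrimeProduct.forced_eq']
    have hn' : n / 2 + (n - n / 2) = n := by omega
    have h1 := ih (n - n / 2) (e / 2 ^ (n / 2)) (by rw [pow_succ] at hn; omega)
      (by rw [Nat.div_lt_iff_lt_mul (by positivity), ← pow_add, add_comm, hn']; exact he) hT
    have h2 := ih (n / 2) (e % 2 ^ (n / 2)) (by rw [pow_succ] at hn; omega)
      (Nat.mod_lt _ (by positivity)) h1
    convert h2 using 1
    rw [smul_add, smul_smul, smul_smul, ← pow_add, hn', add_assoc, ← add_smul, Nat.div_add_mod]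

theorem Represents.mul (h0 : 0 < N) (hN : (N : F) = 0) {m : ℕ} (hm : m ≠ 0) {T : JacobianCoords}
    {P : (cmCurve F).Point} (hT : Represents T P) : Represents (mul N m T) (m • P) := by
  have h1 : 2 ^ m.log2 ≤ m := Nat.log2_self_le hm
  have h2 : m < 2 ^ (m.log2 + 1) := Nat.lt_log2_self
  rw [pow_succ] at h2
  have h3 := Represents.mulAux h0 hN hT (m.log2.log2 + 1) m.log2 (m - 2 ^ m.log2)
    Nat.lt_log2_self.le (by omega) hT
  rw [← add_smul, Nat.add_sub_cancel' h1] at h3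
  simpa only [JacobianCoords.mul, PrimeProduct.forced_eq'] using h3

end Soundness

/-- Checks that `(value c / q) * T` is not zero modulo any prime factor of `N`, for all factors `q`
of `c`. -/
def ordersCheck (N : ℕ) : PrimeProduct → JacobianCoords → Bool
  | .mul b c, T => forced (ordersCheck N b) (mul N c.value T) &&
    forced (ordersCheck N c) (mul N b.value T)
  | _, T => Nat.gcd N T.z == 1

/-- Checks that modulo all prime factors of `N` the point with abscissa 3 and ordinate `y` is on
the curve `y² = x³ - 4x² + 2x`, and that `value c` divides the order of the point, by means of a
multiple `2 * e` of this order. -/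
def pointCheck (N y e : ℕ) (c : PrimeProduct) : Bool :=
  (y * y + 3) % N == 0 &&
  forced (fun S => Nat.gcd N S.z == 1 && S.y == 0) (mul N e ⟨3, y, 1⟩) &&
  _root_.forced (fun m => m * c.value == 2 * e && forced (ordersCheck N c) (mul N m ⟨3, y, 1⟩))
    (2 * e / c.value)

theorem cast_ne_zero_of_gcd {N p a : ℕ} (hp : p.Prime) (h : p ∣ N) (ha : Nat.gcd N a = 1) :
    (a : ZMod p) ≠ 0 := fun h0 => hp.one_lt.ne'
  (Nat.dvd_one.1 (ha ▸ Nat.dvd_gcd h ((ZMod.natCast_eq_zero_iff _ _).1 h0)))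

theorem prime_dvd_card {N p q : ℕ} [Fact p.Prime] (hp : p ∣ N) (hq : q.Prime) {T : JacobianCoords}
    {P : (cmCurve (ZMod p)).Point} (hT : Represents T P) (hP : q • P = 0)
    (h : Nat.gcd N T.z = 1) : q ∣ Nat.card (cmCurve (ZMod p)).Point := by
  have := Fact.mk hq
  obtain ⟨x, y, hxy, rfl, -⟩ := hT (cast_ne_zero_of_gcd Fact.out hp h)
  rw [← addOrderOf_eq_prime hP (WeierstrassCurve.Affine.Point.some_ne_zero _)]
  exact addOrderOf_dvd_natCard _

/-- This is the analogue of the product tree for Pocklington's criterion, in the group of points. -/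
theorem value_dvd_card_of_ordersCheck {N p : ℕ} [Fact p.Prime] (hp : p ∣ N) (h0 : 0 < N) :
    ∀ (c : PrimeProduct) (T : JacobianCoords) (P : (cmCurve (ZMod p)).Point), c.Sound →
      Represents T P → c.value • P = 0 → ordersCheck N c T = true →
      c.value ∣ Nat.card (cmCurve (ZMod p)).Point
  | .small _, _, _, hs, hT, hP, h => prime_dvd_card hp hs hT hP (by simpa [ordersCheck] using h)
  | .pocklington _ _ _ _, _, _, hs, hT, hP, h =>
    prime_dvd_card hp hs hT hP (by simpa [ordersCheck] using h)
  | .lucas _ _ _ _ _, _, _, hs, hT, hP, h =>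
    prime_dvd_card hp hs hT hP (by simpa [ordersCheck] using h)
  | .mul b c, T, P, hs, hT, hP, h => by
    have hN : (N : ZMod p) = 0 := (ZMod.natCast_eq_zero_iff _ _).2 hp
    simp only [ordersCheck, forced_eq'', Bool.and_eq_true] at h
    refine hs.1.mul_dvd_of_dvd_of_dvd
      (value_dvd_card_of_ordersCheck hp h0 b _ (c.value • P) hs.2.1
        (hT.mul h0 hN hs.2.2.value_pos.ne') ?_ h.1)
      (value_dvd_card_of_ordersCheck hp h0 c _ (b.value • P) hs.2.2
        (hT.mul h0 hN hs.2.1.value_pos.ne') ?_ h.2)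
    · rw [smul_smul]; exact hP
    · rw [smul_smul, mul_comm]; exact hP

/-- The zero point cannot be certified in these coordinates. Instead e P is shown to be an affine
point with ordinate 0, hence of order 2, so that 2 e annihilates P. -/
theorem value_dvd_card {N p y e : ℕ} {c : PrimeProduct} (hc : c.Sound) [Fact p.Prime]
    (hp : p ∣ N) (h2 : p ≠ 2) (h0 : 0 < N) (he : e ≠ 0) (h : pointCheck N y e c = true) :
    c.value ∣ Nat.card (cmCurve (ZMod p)).Point := by
  have hN : (N : ZMod p) = 0 := (ZMod.natCast_eq_zero_iff _ _).2 hp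
  simp only [pointCheck, forced_eq'', PrimeProduct.forced_eq', Bool.and_eq_true, beq_iff_eq] at h
  obtain ⟨⟨h1, h3, h4⟩, h5, h6⟩ := h
  have h20 : (2 : ZMod p) ≠ 0 := by
    intro h
    have h7 : p ∣ 2 := by
      rw [← ZMod.natCast_eq_zero_iff]
      exact_mod_cast h
    exact h2 ((Nat.prime_dvd_prime_iff_eq Fact.out Nat.prime_two).1 h7)
  -- At x = 3 the cubic has the value 27 - 36 + 6 = -3.
  have hon : (cmCurve (ZMod p)).Nonsingular 3 (y : ZMod p) := by
    rw [cmCurve.nonsingular_iff h20]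
    have h7 : ((y * y + 3 : ℕ) : ZMod p) = 0 :=
      (ZMod.natCast_eq_zero_iff _ _).2 (hp.trans (Nat.dvd_of_mod_eq_zero h1))
    push_cast at h7
    linear_combination h7
  set P : (cmCurve (ZMod p)).Point := .some _ _ hon with hP
  have hr : Represents (F := ZMod p) ⟨3, y, 1⟩ P := fun _ => ⟨_, _, hon, rfl, by simp, by simp⟩
  refine value_dvd_card_of_ordersCheck hp h0 c _ ((2 * e / c.value) • P) hc
    (hr.mul h0 hN ?_) ?_ h6
  · intro h7
    rw [h7] at h5
    omega
  · rw [smul_smul, mul_comm, h5, mul_smul, two_nsmul]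
    obtain ⟨x, y', hxy, hs, hx, hy⟩ := hr.mul h0 hN he (cast_ne_zero_of_gcd Fact.out hp h3)
    have hy0 : y' = 0 := by
      rw [h4, Nat.cast_zero] at hy
      exact (mul_eq_zero.1 hy).resolve_right
        (pow_ne_zero _ (cast_ne_zero_of_gcd Fact.out hp h3))
    rw [hs]
    exact WeierstrassCurve.Affine.Point.add_self_of_Y_eq (by
      simp [WeierstrassCurve.Affine.negY, cmCurve, hy0])

end JacobianCoords

/-! ### Factorizations in ℤ[√-2] -/

theorem PrimeProduct.Sound.squarefree : ∀ {c : PrimeProduct}, c.Sound → Squarefree c.value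
  | .small _, h => Irreducible.squarefree h
  | .pocklington _ _ _ _, h => Irreducible.squarefree h
  | .lucas _ _ _ _ _, h => Irreducible.squarefree h
  | .mul _ _, h => (Nat.squarefree_mul h.1).2 ⟨h.2.1.squarefree, h.2.2.squarefree⟩

/-- The difference of the two multiples of M is 2 (a - 1). Oddness gives M ∣ a - 1, hence M ∣ b ^ 2,
and squarefreeness gives M ∣ b. -/
theorem dvd_of_dvd_norm {M : ℕ} {a b : ℤ} (hM : Squarefree M) (h2 : Odd M)
    (h : (M : ℤ) ∣ a ^ 2 + 2 * b ^ 2 - 1) (h' : (M : ℤ) ∣ (a - 1) ^ 2 + 2 * b ^ 2) :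
    (M : ℤ) ∣ a - 1 ∧ (M : ℤ) ∣ b := by
  have hc : IsCoprime (M : ℤ) 2 := by
    have := Nat.isCoprime_iff_coprime.2 (Nat.coprime_two_right.2 h2)
    exact_mod_cast this
  have h1 : (M : ℤ) ∣ a - 1 := by
    refine hc.dvd_of_dvd_mul_left ?_
    convert dvd_sub h h' using 1
    ring
  refine ⟨h1, ?_⟩
  have h3 : (M : ℤ) ∣ b ^ 2 := by
    refine hc.dvd_of_dvd_mul_left ?_
    convert dvd_sub h' (h1.mul_right (a - 1)) using 1
    ring
  have h4 : Squarefree (M : ℤ) := Int.squarefree_natCast.2 hM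
  exact (h4.dvd_pow_iff_dvd two_ne_zero).1 h3

/-- Factorizations of `A + B √-2` that come from a factorization of the norm. -/
theorem exists_eq_mul_of_norm_eq {M r q : ℕ} {A B a b : ℤ} (hr : r.Prime)
    (hN : ((r * q : ℕ) : ℤ) = A ^ 2 + 2 * B ^ 2) (hA : (M : ℤ) ∣ A - 1) (hB : (M : ℤ) ∣ B)
    (hab : (r : ℤ) = a ^ 2 + 2 * b ^ 2) (ha : (M : ℤ) ∣ a - 1) (hb : (M : ℤ) ∣ b) :
    ∃ a b c d : ℤ, (r : ℤ) = a ^ 2 + 2 * b ^ 2 ∧ (q : ℤ) = c ^ 2 + 2 * d ^ 2 ∧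
      A = a * c - 2 * (b * d) ∧ B = a * d + b * c ∧
      (M : ℤ) ∣ a - 1 ∧ (M : ℤ) ∣ b ∧ (M : ℤ) ∣ c - 1 ∧ (M : ℤ) ∣ d := by
  have hp : Prime (r : ℤ) := Nat.prime_iff_prime_int.1 hr
  have hr0 : (r : ℤ) ≠ 0 := hp.ne_zero
  push_cast at hN
  -- The prime r divides (a B - A b) (a B + A b), because both norms vanish modulo r; conjugation of
  -- a + b √-2 exchanges the two factors.
  wlog h : (r : ℤ) ∣ a * B - A * b generalizing b
  · refine this (b := -b) (by rw [hab]; ring) hb.neg_right ?_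
    have h1 : (r : ℤ) ∣ (a * B - A * b) * (a * B - A * -b) :=
      ⟨B ^ 2 - b ^ 2 * q, by linear_combination -B ^ 2 * hab + b ^ 2 * hN⟩
    exact (hp.dvd_mul.1 h1).resolve_left h
  obtain ⟨d, hd⟩ := h
  -- Multiplicativity of the norm: (a A + 2 b B) ^ 2 + 2 (a B - A b) ^ 2 = r (r q). So the quotient
  -- c + d √-2 of A + B √-2 by a + b √-2 is integral.
  have h1 : (r : ℤ) ∣ a * A + 2 * (b * B) := by
    refine hp.dvd_of_dvd_pow (n := 2) ⟨r * q - 2 * (d * (a * B - A * b)), ?_⟩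
    linear_combination (-r) * hN - (A ^ 2 + 2 * B ^ 2) * hab - 2 * (a * B - A * b) * hd
  obtain ⟨c, hc⟩ := h1
  have eA : A = a * c - 2 * (b * d) := by
    refine mul_left_cancel₀ hr0 ?_
    linear_combination A * hab + a * hc - 2 * b * hd
  have eB : B = a * d + b * c := by
    refine mul_left_cancel₀ hr0 ?_
    linear_combination B * hab + a * hd + b * hc
  obtain ⟨a', ha'⟩ := id ha
  obtain ⟨b', hb'⟩ := id hb
  obtain ⟨A', hA'⟩ := id hA
  obtain ⟨B', hB'⟩ := id hB
  have hrM : (M : ℤ) ∣ r - 1 := ⟨a' * (a + 1) + 2 * (b' * b), by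
    linear_combination hab + (a + 1) * ha' + 2 * b * hb'⟩
  obtain ⟨r', hr'⟩ := hrM
  refine ⟨a, b, c, d, hab, ?_, eA, eB, ha, hb, ?_, ?_⟩
  · refine mul_left_cancel₀ hr0 ?_
    rw [hN, eA, eB, hab]
    ring
  · refine ⟨a' * A + A' + 2 * (b' * B) - r' * c, ?_⟩
    linear_combination -hc + A * ha' + hA' + 2 * B * hb' - c * hr'
  · refine ⟨a * B' - A * b' - r' * d, ?_⟩
    linear_combination -hd + a * hB' - A * hb' - d * hr'

/-- A factorization `A + B √-2 = (a + b √-2) (c + d √-2)` with all factors 1 modulo `M`, where the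
factors on the right have the norms `p` and `q`. -/
structure NormFactorization (M : ℕ) (A B : ℤ) (p q : ℕ) (a b c d : ℤ) : Prop where
  norm_left : (p : ℤ) = a ^ 2 + 2 * b ^ 2
  norm_right : (q : ℤ) = c ^ 2 + 2 * d ^ 2
  re_eq : A = a * c - 2 * (b * d)
  im_eq : B = a * d + b * c
  dvd_re_left : (M : ℤ) ∣ a - 1
  dvd_im_left : (M : ℤ) ∣ b
  dvd_re_right : (M : ℤ) ∣ c - 1
  dvd_im_right : (M : ℤ) ∣ d

theorem NormFactorization.symm {M : ℕ} {A B : ℤ} {p q : ℕ} {a b c d : ℤ}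
    (h : NormFactorization M A B p q a b c d) : NormFactorization M A B q p c d a b :=
  ⟨h.norm_right, h.norm_left, by rw [h.re_eq]; ring, by rw [h.im_eq]; ring, h.dvd_re_right,
    h.dvd_im_right, h.dvd_re_left, h.dvd_im_left⟩

/-- The shape of the factorizations of a number that is 3 modulo 8 and a norm from `ℤ[√-2]` into
two primes, given points on `cmCurve` modulo the factors. -/
theorem exists_normFactorization {N M p q : ℕ} {A B : ℤ} (hp : p.Prime) (hq : q.Prime)
    (hN : N = p * q) (h8 : N % 8 = 3) (hAB : (N : ℤ) = A ^ 2 + 2 * B ^ 2)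
    (hA : (M : ℤ) ∣ A - 1) (hB : (M : ℤ) ∣ B) (hM : Squarefree M) (hM2 : Odd M)
    (h1 : ∀ r : ℕ, r.Prime → r ∣ N → M ∣ r - 1) (hB' : ∀ r : ℕ, r.Prime → r ∣ N → ¬ (r : ℤ) ∣ B)
    (hE : ∀ r : ℕ, [Fact r.Prime] → r ∣ N → r ≠ 2 → M ∣ Nat.card (cmCurve (ZMod r)).Point) :
    ∃ a b c d : ℤ, NormFactorization M A B p q a b c d := by
  have hodd : ∀ r : ℕ, r ∣ N → r ≠ 2 := by
    rintro r h rfl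
    omega
  have hr : ∀ r : ℕ, r.Prime → r ∣ N → r % 8 = 1 ∨ r % 8 = 3 := by
    intro r hr hd
    have := Fact.mk hr
    have hB0 : (B : ZMod r) ≠ 0 := by
      rw [Ne, ZMod.intCast_zmod_eq_zero_iff_dvd]
      exact hB' r hr hd
    rw [← ZMod.exists_sq_eq_neg_two_iff (hodd r hd)]
    have h0 : (N : ZMod r) = 0 := (ZMod.natCast_eq_zero_iff _ _).2 hd
    have h2 := congrArg (Int.cast : ℤ → ZMod r) hAB
    push_cast at h2
    rw [h0] at h2
    -- A / B is a square root of -2 modulo r.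
    refine ⟨A / B, ?_⟩
    field_simp
    linear_combination h2
  have key : ∀ r s : ℕ, r.Prime → N = r * s → r % 8 = 1 →
      ∃ a b c d : ℤ, NormFactorization M A B r s a b c d := by
    intro r s hr hN' hr8
    have := Fact.mk hr
    have hd : r ∣ N := ⟨s, hN'⟩
    obtain ⟨a, b, hab, hcard⟩ := cmCurve.exists_card_point (F := ZMod r) (by
      rw [ZMod.card]; omega)
    rw [ZMod.card] at hab
    have h2 : (M : ℤ) ∣ (a - 1) ^ 2 + 2 * b ^ 2 := by
      rw [← hcard]
      exact_mod_cast hE r hd (hodd r hd)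
    have h3 : (M : ℤ) ∣ a ^ 2 + 2 * b ^ 2 - 1 := by
      have h4 : ((M : ℕ) : ℤ) ∣ ((r - 1 : ℕ) : ℤ) := Int.natCast_dvd_natCast.2 (h1 r hr hd)
      rw [← hab]
      simpa [hr.one_lt.le] using h4
    obtain ⟨h5, h6⟩ := dvd_of_dvd_norm hM hM2 h3 h2
    rw [hN'] at hAB
    obtain ⟨a, b, c, d, h⟩ := exists_eq_mul_of_norm_eq hr hAB hA hB hab h5 h6
    exact ⟨a, b, c, d, h.1, h.2.1, h.2.2.1, h.2.2.2.1, h.2.2.2.2.1, h.2.2.2.2.2.1,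
      h.2.2.2.2.2.2.1, h.2.2.2.2.2.2.2⟩
  -- The point count is available only for primes 1 modulo 8. One of p and q is such, since 3 * 3 is
  -- not 3 modulo 8.
  rcases hr p hp ⟨q, hN⟩ with h | h
  · exact key p q hp hN h
  · rcases hr q hq ⟨p, by rw [hN, mul_comm]⟩ with h' | h'
    · obtain ⟨a, b, c, d, h⟩ := key q p hq (by rw [hN, mul_comm]) h'
      exact ⟨c, d, a, b, h.symm⟩
    · rw [hN, Nat.mul_mod, h, h'] at h8
      norm_num at h8

/-! ### Norms and coordinates -/

section Size

/-- A number larger than the absolute values of `u` and `v`. -/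
def boxSize (u v : ℤ) : ℕ := max u.natAbs v.natAbs + 1

theorem le_boxSize (u v : ℤ) : |u| + 1 ≤ boxSize u v ∧ |v| + 1 ≤ boxSize u v := by
  rw [boxSize, Int.abs_eq_natAbs, Int.abs_eq_natAbs]
  omega

theorem norm_le_boxSize (M : ℕ) (hM : 2 ≤ M) (u v : ℤ) :
    (1 + M * u) ^ 2 + 2 * (M * v) ^ 2 ≤ 3 * ((M : ℤ) * boxSize u v) ^ 2 := by
  obtain ⟨h1, h2⟩ := le_boxSize u v
  have hM' : (2 : ℤ) ≤ M := by exact_mod_cast hM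
  have h3 : |1 + (M : ℤ) * u| ≤ M * boxSize u v := by
    calc |1 + (M : ℤ) * u| ≤ |1| + |(M : ℤ) * u| := abs_add_le _ _
      _ = 1 + M * |u| := by rw [abs_mul, abs_one, Nat.abs_cast]
      _ ≤ M * boxSize u v := by nlinarith
  have h4 : |(M : ℤ) * v| ≤ M * boxSize u v := by
    rw [abs_mul, Nat.abs_cast]
    nlinarith
  have h5 := sq_le_sq' (abs_le.1 h3).1 (abs_le.1 h3).2
  have h6 := sq_le_sq' (abs_le.1 h4).1 (abs_le.1 h4).2
  linarith

/-- For box sizes from 4 on, the summand 1 in 1 + M u and the 1 in the box size together cost at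
most a factor 2. -/
theorem boxSize_le_norm (M : ℕ) (hM : 2 ≤ M) (u v : ℤ) (h : 4 ≤ boxSize u v) :
    ((M : ℤ) * boxSize u v) ^ 2 ≤ 4 * ((1 + M * u) ^ 2 + 2 * (M * v) ^ 2) := by
  have hM' : (2 : ℤ) ≤ M := by exact_mod_cast hM
  have hD : (4 : ℤ) ≤ boxSize u v := by exact_mod_cast h
  rcases le_total v.natAbs u.natAbs with h1 | h1
  · have e : (boxSize u v : ℤ) = |u| + 1 := by
      rw [boxSize, max_eq_left h1, Int.abs_eq_natAbs]; push_cast; rfl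
    have h2 : M * (boxSize u v : ℤ) ≤ 2 * |1 + M * u| := by
      have h3 : |(M : ℤ) * u| ≤ |1 + M * u| + 1 := by
        calc |(M : ℤ) * u| = |(1 + M * u) - 1| := by congr 1; ring
          _ ≤ |1 + M * u| + |(1 : ℤ)| := abs_sub _ _
          _ = _ := by rw [abs_one]
      rw [abs_mul, Nat.abs_cast] at h3
      nlinarith
    have h3 : (M * (boxSize u v : ℤ)) ^ 2 ≤ (2 * |1 + M * u|) ^ 2 := by
      have : 0 ≤ (M : ℤ) * boxSize u v := by positivity
      exact pow_le_pow_left₀ this h2 2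
    rw [mul_pow 2, sq_abs] at h3
    nlinarith [sq_nonneg ((M : ℤ) * v)]
  · have e : (boxSize u v : ℤ) = |v| + 1 := by
      rw [boxSize, max_eq_right h1, Int.abs_eq_natAbs]; push_cast; rfl
    have h2 : M * (boxSize u v : ℤ) ≤ 2 * (M * |v|) := by nlinarith
    have h3 : (M * (boxSize u v : ℤ)) ^ 2 ≤ (2 * (M * |v|)) ^ 2 := by
      have : 0 ≤ (M : ℤ) * boxSize u v := by positivity
      exact pow_le_pow_left₀ this h2 2
    have h4 : (2 * ((M : ℤ) * |v|)) ^ 2 = 4 * (M * v) ^ 2 := by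
      rw [mul_pow, mul_pow, sq_abs, mul_pow]; ring
    rw [h4] at h3
    nlinarith [sq_nonneg ((M : ℤ) * v), sq_nonneg (1 + (M : ℤ) * u)]

end Size

/-! ### The linear congruence for the sum of the factors -/

/-- The representative of smallest absolute value of `z` modulo `n`. -/
def balance (n z : ℤ) : ℤ := forcedInt (fun r => bif decide (n < 2 * r) then r - n else r) (z % n)

/-- Excludes the factorizations `A + B √-2 = (a + b √-2) (c + d √-2)` where all factors are 1 modulo
`M`, where the norms of the factors on the right are 1 modulo `G`, and where the coordinates of
`(a + b √-2 - 1) / M` and `(c + d √-2 - 1) / M` are less than `Y` in absolute value; by a linear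
congruence for their sum. -/
def sumCheck (M G A B Y t : ℤ) : Bool :=
  forcedInt (fun r => forcedInt (fun s => forcedInt (fun e₀ => forcedInt (fun e₁ =>
    forcedInt (fun e₂ => forcedInt (fun w => decide (w < e₂ ∧ e₂ + w < G))
      ((|e₀| + |e₁|) * (2 * Y / M + 1)))
      (t * ((2 + M * r) * (A - 1) + 2 * M * s * B) % G))
      (balance G (2 * t * M ^ 2 * B)))
      (balance G (t * M ^ 2 * (A - 1))))
      (B / M % M)) ((A - 1) / M % M)

theorem balance_modEq (n z : ℤ) : balance n z ≡ z [ZMOD n] := by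
  rw [balance, forcedInt_eq]
  cases decide (n < 2 * (z % n))
  · exact Int.mod_modEq z n
  · have h := (Int.mod_modEq z n).sub (Int.modEq_zero_iff_dvd.2 (dvd_refl n))
    rwa [sub_zero] at h

theorem exists_eq_emod_add {M Y P S k : ℤ} (hM : 0 < M) (h : P = S + M * k) (hS : |S| ≤ 2 * Y) :
    ∃ c, S = P % M + M * c ∧ |c| ≤ 2 * Y / M + 1 := by
  have h1 : S = P % M + M * (P / M - k) := by
    have := Int.emod_add_mul_ediv P M
    linear_combination -this - h
  refine ⟨_, h1, ?_⟩
  have h2 := Int.emod_nonneg P hM.ne'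
  have h3 := Int.emod_lt_of_pos P hM
  have h4 : (|P / M - k| - 1) * M ≤ 2 * Y := by
    have h5 : |M * (P / M - k)| ≤ |S| + M := by
      calc |M * (P / M - k)| = |S - P % M| := by congr 1; linear_combination -h1
        _ ≤ |S| + |P % M| := abs_sub _ _
        _ ≤ _ := by rw [abs_of_nonneg h2]; linarith
    rw [abs_mul, abs_of_pos hM] at h5
    linarith
  have := (Int.le_ediv_iff_mul_le hM).2 h4
  linarith

/-- The products of coordinates enter A and B with the factor M ^ 2, so A and B reveal u + u' and v
+ v' modulo M. The unknown quotients c₀ and c₁ are bounded, and they satisfy a congruence modulo G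
whose constant term keeps the whole expression strictly between 0 and G. -/
theorem NormFactorization.not_of_sumCheck {M : ℕ} {A B G Y t : ℤ} {p q : ℕ} {u v u' v' : ℤ}
    (h : NormFactorization M A B p q (1 + M * u) (M * v) (1 + M * u') (M * v')) (hM : 0 < M)
    (hp : G ∣ p - 1) (hq : G ∣ q - 1) (hu : |u| ≤ Y) (hv : |v| ≤ Y) (hu' : |u'| ≤ Y)
    (hv' : |v'| ≤ Y) (hc : sumCheck M G A B Y t = true) : False := by
  have hM' : (0 : ℤ) < M := by exact_mod_cast hM
  have e0 : (A - 1) / M = (u + u') + M * (u * u' - 2 * (v * v')) := by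
    rw [Int.ediv_eq_of_eq_mul_right hM'.ne']
    rw [h.re_eq]; ring
  have e1 : B / M = (v + v') + M * (u * v' + v * u') := by
    rw [Int.ediv_eq_of_eq_mul_right hM'.ne']
    rw [h.im_eq]; ring
  obtain ⟨c₀, h0, hc0⟩ := exists_eq_emod_add hM' e0
    ((abs_add_le u u').trans (by linarith : |u| + |u'| ≤ 2 * Y))
  obtain ⟨c₁, h1, hc1⟩ := exists_eq_emod_add hM' e1
    ((abs_add_le v v').trans (by linarith : |v| + |v'| ≤ 2 * Y))
  simp only [sumCheck, forcedInt_eq, decide_eq_true_eq] at hc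
  set r := (A - 1) / M % M
  set s := B / M % M
  obtain ⟨hc2, hc3⟩ := hc
  set e₂ := t * ((2 + M * r) * (A - 1) + 2 * M * s * B) % G with he2
  set x₀ := balance G (t * M ^ 2 * (A - 1)) with hx0
  set x₁ := balance G (2 * t * M ^ 2 * B) with hx1
  have key : G ∣ (2 + M * (u + u')) * (A - 1) + 2 * (M * (v + v')) * B := by
    obtain ⟨p', hp'⟩ := hp
    obtain ⟨q', hq'⟩ := hq
    refine ⟨(1 + M * u') * p' + (1 + M * u) * q', ?_⟩
    -- Multiplying A + B √-2 by the conjugate of one factor gives that factor's norm times the other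
    -- factor. The real parts add up to (a + c) A + 2 (b + d) B = p c + q a; subtract a + c.
    have e3 : (2 + M * (u + u')) * (A - 1) + 2 * (M * (v + v')) * B =
        (1 + M * u') * ((p : ℤ) - 1) + (1 + M * u) * (q - 1) := by
      rw [h.norm_left, h.norm_right, h.re_eq, h.im_eq]
      ring
    rw [e3, hp', hq']
    ring
  have h2 : x₀ * c₀ + x₁ * c₁ + e₂ ≡ 0 [ZMOD G] := by
    have h3 := (((balance_modEq G (t * M ^ 2 * (A - 1))).mul_right c₀).add
      ((balance_modEq G (2 * t * M ^ 2 * B)).mul_right c₁)).add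
      (Int.mod_modEq (t * ((2 + M * r) * (A - 1) + 2 * M * s * B)) G)
    refine h3.trans (Int.modEq_zero_iff_dvd.2 ?_)
    refine (key.mul_left t).trans (dvd_of_eq ?_)
    rw [h0, h1]
    ring
  have hw : |x₀ * c₀ + x₁ * c₁| ≤ (|x₀| + |x₁|) * (2 * Y / M + 1) := by
    refine (abs_add_le _ _).trans ?_
    rw [abs_mul, abs_mul, add_mul]
    gcongr
  obtain ⟨h4, h5⟩ := abs_le.1 hw
  obtain ⟨k, hk⟩ := Int.modEq_zero_iff_dvd.1 h2
  have hG : 0 < G := by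
    have := (abs_nonneg _).trans hw
    linarith
  have h6 : 0 < G * k := by rw [← hk]; linarith
  have h7 : G * k < G * 1 := by rw [← hk]; linarith
  have h8 := pos_of_mul_pos_right h6 hG.le
  have h9 := lt_of_mul_lt_mul_left h7 hG.le
  omega

/-! ### The primality criterion -/

/-- A primality criterion for norms from `ℤ[√-2]`. All factors of `N` are 1 modulo `c.value`, all
factors of `A + B √-2` are 1 modulo `c'.value`, up to conjugation. -/
theorem Nat.Prime.of_norm {N a l y e : ℕ} {A B : ℤ} {c c' : PrimeProduct} {L : List FactorFree}
    {G Y t : ℤ}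
    (hN : 1 < N) (h8 : N % 8 = 3) (hAB : (N : ℤ) = A ^ 2 + 2 * B ^ 2) (hB : Int.gcd N B = 1)
    (hc : c.check = true) (h1 : c.modOneCheck N a = true) (hc' : c'.check = true)
    (hodd : c'.value % 2 = 1) (hM2 : 2 ≤ c'.value) (hF : (c.value : ℤ) = c'.value * G)
    (hA : A % c'.value = 1) (hB0 : B % c'.value = 0) (he : e ≠ 0)
    (hE : JacobianCoords.pointCheck N y e c' = true)
    (hL : ∀ d ∈ L, 0 < d.top)
    (h2 : forced (fun F => forced (fun R => FactorFree.checkAll N F R (fun T =>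
      Nat.blt 0 T && Nat.blt (3 * (R / F / F / T)) F &&
        FactorFree.cubicCheck (R % F : ℕ) (R / F % F : ℕ) (R / F / F : ℕ) l &&
        decide (48 * (c'.value : ℤ) ^ 2 ≤ T * F ∧ 4 * (N : ℤ) ≤ (c'.value * Y) ^ 2 * (T * F))) 1 L)
        ((N - 1) / F)) c.value = true)
    (hY : 0 ≤ Y)
    (hS : sumCheck c'.value G A B Y t = true) : N.Prime := by
  have hs := PrimeProduct.sound_of_check c hc
  have hs' := PrimeProduct.sound_of_check c' hc'
  by_contra hNp
  have hN0 : 0 < N := by omega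
  obtain ⟨-, hF1⟩ := PrimeProduct.value_dvd_of_modOneCheck hs hN0 h1
  obtain ⟨p, q, T, hp, hq, hpq, hle, hT, hTp⟩ := exists_prime_mul_prime hN hNp hs h1
    (f := fun F T => decide (48 * (c'.value : ℤ) ^ 2 ≤ T * F ∧
      4 * (N : ℤ) ≤ (c'.value * Y) ^ 2 * (T * F))) hL h2
  have hpN : p ∣ N := ⟨q, hpq⟩
  have hqN : q ∣ N := ⟨p, by rw [hpq, mul_comm]⟩
  set M := c'.value with hM
  have hMF : (M : ℤ) ∣ c.value := ⟨G, hF⟩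
  have hM1 : ∀ r : ℕ, r.Prime → r ∣ N → M ∣ r - 1 := fun r hr hd =>
    (Int.natCast_dvd_natCast.1 hMF).trans (hF1 r hr hd)
  have hsub : ∀ r : ℕ, r.Prime → ((r - 1 : ℕ) : ℤ) = r - 1 := fun r hr => by
    rw [Nat.cast_sub hr.one_lt.le, Nat.cast_one]
  have hFr : ∀ r : ℕ, r.Prime → r ∣ N → (c.value : ℤ) ∣ r - 1 := fun r hr hd => by
    rw [← hsub r hr]
    exact Int.natCast_dvd_natCast.2 (hF1 r hr hd)
  have hGr : ∀ r : ℕ, r.Prime → r ∣ N → G ∣ r - 1 := fun r hr hd =>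
    (Dvd.intro_left _ hF.symm).trans (hFr r hr hd)
  have hcB : IsCoprime (N : ℤ) B := Int.isCoprime_iff_gcd_eq_one.2 hB
  have hodd' : Odd M := Nat.odd_iff.2 hodd
  obtain ⟨a', b', c₁, d₁, hfac⟩ := exists_normFactorization (M := M) hp hq hpq h8 hAB
    (Int.dvd_of_emod_eq_zero (by
      rw [Int.sub_emod, hA, Int.emod_eq_of_lt (by norm_num : (0 : ℤ) ≤ 1) (by
        have : (2 : ℤ) ≤ M := by exact_mod_cast hM2
        linarith)]
      simp))
    (Int.dvd_of_emod_eq_zero hB0) hs'.squarefree hodd' hM1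
    (fun r hr hd hrB => by
      have h3 := hcB.isUnit_of_dvd' (Int.natCast_dvd_natCast.2 hd) hrB
      rw [Int.isUnit_iff_natAbs_eq, Int.natAbs_natCast] at h3
      exact hr.one_lt.ne' h3)
    (fun r _ hd h2 => JacobianCoords.value_dvd_card hs' hd h2 hN0 he hE)
  obtain ⟨u, hu⟩ := hfac.dvd_re_left
  obtain ⟨v, rfl⟩ := hfac.dvd_im_left
  obtain ⟨u', hu'⟩ := hfac.dvd_re_right
  obtain ⟨v', rfl⟩ := hfac.dvd_im_right
  obtain rfl : a' = 1 + M * u := by linarith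
  obtain rfl : c₁ = 1 + M * u' := by linarith
  have hM0 : (0 : ℤ) < M := by
    have : 0 < M := by omega
    exact_mod_cast this
  have hp0 : (0 : ℤ) < p := by exact_mod_cast hp.pos
  have hpq' : (p : ℤ) ≤ q := by exact_mod_cast hle
  obtain ⟨hT1, hT2⟩ := of_decide_eq_true hT
  have hTp' : (T : ℤ) * c.value ≤ p := by exact_mod_cast hTp
  have n1 := norm_le_boxSize M hM2 u v
  have n2 := norm_le_boxSize M hM2 u' v'
  rw [← hfac.norm_left] at n1
  rw [← hfac.norm_right] at n2
  -- 48 = 3 * 4 ^ 2, so a norm of at least 48 M ^ 2 forces box size 4, as the lower bound for norms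
  -- requires.
  have low : ∀ E : ℕ, 48 * (M : ℤ) ^ 2 ≤ 3 * ((M : ℤ) * E) ^ 2 → 4 ≤ E := by
    intro E hE
    have h3 : ((M : ℤ) * 4) ^ 2 ≤ ((M : ℤ) * E) ^ 2 := by linarith
    exact_mod_cast le_of_mul_le_mul_left (le_of_sq_le_sq h3 (by positivity)) hM0
  have m1 := boxSize_le_norm M hM2 u v (low _ ((hT1.trans hTp').trans n1))
  have m2 := boxSize_le_norm M hM2 u' v' (low _ (((hT1.trans hTp').trans hpq').trans n2))
  rw [← hfac.norm_left] at m1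
  rw [← hfac.norm_right] at m2
  -- The lower bound T F for p bounds q = N / p from above.
  have h4 : 4 * (q : ℤ) ≤ (M * Y) ^ 2 := by
    refine le_of_mul_le_mul_right ?_ hp0
    calc 4 * (q : ℤ) * p = 4 * N := by rw [hpq]; push_cast; ring
      _ ≤ _ := hT2.trans (mul_le_mul_of_nonneg_left hTp' (sq_nonneg _))
  have up : ∀ E : ℕ, ((M : ℤ) * E) ^ 2 ≤ 4 * q → (E : ℤ) ≤ Y := by
    intro E hE
    exact le_of_mul_le_mul_left (le_of_sq_le_sq (hE.trans h4) (by positivity)) hM0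
  have y1 := up _ (m1.trans (by linarith))
  have y2 := up _ m2
  have b1 := le_boxSize u v
  have b2 := le_boxSize u' v'
  exact hfac.not_of_sumCheck (by omega) (hGr p hp hpN) (hGr q hq hqN) (by linarith) (by linarith)
    (by linarith) (by linarith) hS

/-! ### Certificates and computations for the exponent 12391 -/

/-- The primes dividing `wagstaff 12391 - 1` and the order of a point on `cmCurve`. -/
def orderCertificate : PrimeProduct :=
    .mul (.mul (.mul (.pocklington
    0x3c7e7e1e416fb638c41c37954094a205c7330789791adbcd9f38a0c77bbc530f54bd60788b97902c220190bc1 3 1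
    (.pocklington 0x21037fb4aab9c6776b03e1e4292791ebc875c1bba28bd368d5d95feb7741eb433f478c3c0a4a639
    2 1 (.pocklington 0x8c3252150cf1a73238211a0889d073e7849150779a0f86a8fe23b588e464113 2 5 (.mul
    (.pocklington 0xab3685de14ecb46afd7b 2 3 (.mul (.pocklington 3049 2 1 (.small 127)) (.mul
    (.small 937) (.small 397)))) (.small 43))))) (.small 11)) (.mul (.mul (.mul (.pocklington
    0x1a597c663d0ac5a9 3 7 (.mul (.pocklington 82031 2 3 (.mul (.small 13) (.small 5))) (.small
    23))) (.mul (.pocklington 86171 2 3 (.mul (.small 7) (.mul (.small 5) (.small 2))))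
    (.pocklington 5419 3 5 (.mul (.small 7) (.small 3))))) (.mul (.pocklington 0x40cf8ef3119 3 1
    (.pocklington 0xbb79a913 2 5 (.mul (.small 1109) (.small 2)))) (.mul (.pocklington 0xcb720a3493
    3 7 (.mul (.small 1753) (.mul (.small 3) (.small 2)))) (.small 281)))) (.mul (.mul (.pocklington
    0x25e9376e6bd9bf3 5 3 (.mul (.small 911) (.mul (.small 59) (.mul (.small 7) (.small 2))))) (.mul
    (.pocklington 664441 6 7 (.mul (.small 7) (.mul (.small 5) (.small 3)))) (.pocklington 2833 2 1
    (.small 59)))) (.mul (.pocklington 0x115e0ac20e40eb3 3 5 (.mul (.pocklington 52379 2 1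
    (.pocklington 26189 2 1 (.pocklington 6547 2 1 (.small 1091)))) (.mul (.small 5) (.small 2))))
    (.mul (.pocklington 0x1ec59a19 5 3 (.mul (.mul (.small 11) (.small 3)) (.mul (.small 7) (.small
    5)))) (.small 43)))))) (.mul (.mul (.pocklington
    0x31c743283a242f247eaf522059801e7ef92d2d5e0c85ee836b3ee4ab0c7f953e6e76083 3 11 (.mul (.mul
    (.pocklington 0x5240d9f1 2 1 (.pocklington 0x923a67 3 7 (.mul (.small 47) (.mul (.small 3)
    (.small 2))))) (.mul (.small 59) (.mul (.small 3) (.small 2)))) (.mul (.pocklington 0x2ee4f5b3 2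
    1 (.pocklington 0x1611649 2 1 (.pocklington 33247 2 1 (.small 1847)))) (.pocklington 0x30f09dd 2
    1 (.pocklington 0xc3c277 2 1 (.pocklington 712739 2 3 (.mul (.small 79) (.small 2)))))))) (.mul
    (.pocklington 0x224326ed8d9 11 5 (.mul (.small 1667) (.mul (.small 5) (.small 2)))) (.mul
    (.pocklington 37171 3 11 (.mul (.small 7) (.mul (.small 3) (.small 2)))) (.mul (.small 827)
    (.small 331))))) (.mul (.pocklington
    0x1745d1745d1745ce8ba2e8ba2e8ba345d1745d1745d168ba2e8ba2e8ba3 10 5 (.mul (.mul (.pocklington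
    0x2e4851 7 11 (.mul (.small 29) (.mul (.small 3) (.small 2)))) (.mul (.small 233) (.mul (.small
    167) (.small 5)))) (.mul (.mul (.small 2089) (.mul (.small 59) (.mul (.small 3) (.small 2))))
    (.mul (.small 1103) (.small 881))))) (.mul (.mul (.pocklington 0x169ba02c44fe03 3 13 (.mul
    (.small 919) (.mul (.mul (.small 7) (.small 2)) (.mul (.small 5) (.small 3))))) (.small 211))
    (.mul (.pocklington 0x6cc31c19 3 3 (.mul (.small 59) (.small 37))) (.mul (.pocklington 0x17e0f9
    13 13 (.mul (.mul (.small 7) (.small 2)) (.mul (.small 5) (.small 3)))) (.pocklington 13099 3 7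
    (.small 37)))))))

/-- Other primes dividing `wagstaff 12391 - 1`. -/
def cofactorCertificate : PrimeProduct :=
    .mul (.mul (.lucas
    0x2e77674eaf70598bb78fdd230b6fa5deb1c0c2bed548698f2257bcef3056db98c9a01eed35afaade57a25b880e077f425d9
    11
    0x94b14a95649ab8257e992a09be3212c89f35a262aa8151ca077f2963cde2beb5b866c95d7898892de53abe802ce4ca6df7
    0x94b14a95649ab8257e992a09be3212c89f35a262aa8151ca077f2963cde2beb5b866c95d7898892de53abe802ce4ca6df8
    (.pocklington 0x1a4cc0aa2297ee5d4e9a97d80ecb05cb3ac2bf2bdbb340ba0c6f4d80204443850f 3 7 (.mul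
    (.pocklington 0x43fedca96e65ecd8fbb88f 2 1 (.pocklington 0xe26e43f91c61fcfeb21 5 5 (.mul
    (.pocklington 65183 5 7 (.mul (.small 23) (.small 2))) (.mul (.small 109) (.mul (.small 3)
    (.small 2)))))) (.small 2)))) (.mul (.mul (.mul (.pocklington 0x7fdd5e49fcc05327 3 5 (.mul (.mul
    (.small 283) (.small 5)) (.mul (.small 59) (.mul (.small 11) (.small 3))))) (.mul (.pocklington
    122921 3 3 (.mul (.small 7) (.mul (.small 5) (.small 2)))) (.small 7))) (.mul (.mul
    (.pocklington 0x20bd3f89 2 3 (.mul (.small 59) (.mul (.small 5) (.small 3)))) (.pocklington 4721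
    2 3 (.small 59))) (.mul (.pocklington 0x7ad9e8f 3 7 (.mul (.small 37) (.mul (.small 5) (.small
    3)))) (.pocklington 179951 2 5 (.small 59))))) (.mul (.mul (.pocklington 0x19bd771abbfd7 3 1
    (.pocklington 0x10568a173 2 7 (.mul (.small 251) (.mul (.small 5) (.small 2))))) (.mul
    (.pocklington 184081 22 13 (.mul (.small 13) (.mul (.small 3) (.small 2)))) (.mul (.pocklington
    29191 3 7 (.mul (.small 7) (.mul (.small 3) (.small 2)))) (.small 31)))) (.mul (.mul
    (.pocklington 0xe33bf811 3 3 (.mul (.small 59) (.mul (.small 13) (.small 5)))) (.small 127))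
    (.mul (.pocklington 0xfb46f7f 3 5 (.mul (.small 23) (.mul (.small 7) (.mul (.small 3) (.small
    2))))) (.pocklington 152041 11 7 (.mul (.small 7) (.mul (.small 5) (.small 2))))))))) (.mul
    (.mul (.pocklington 0xd3a6507f79fcec585fec3d5e71301faad250b310eb837c3383f 3 1 (.pocklington
    0x1ffc61f8df4c08d753ad01a2fd4b8ea0e32728aede9d1d7 2 7 (.mul (.pocklington 0x14f51c0063 2 3 (.mul
    (.small 73) (.mul (.small 31) (.small 2)))) (.pocklington 0x7e191ef 3 5 (.mul (.small 19) (.mul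
    (.small 5) (.mul (.small 3) (.small 2)))))))) (.mul (.mul (.pocklington 0x2e9db69cff1 3 3 (.mul
    (.small 421) (.small 59))) (.mul (.pocklington 0x586a57 7 3 (.mul (.small 23) (.mul (.small 5)
    (.small 2)))) (.mul (.small 337) (.small 151)))) (.mul (.mul (.pocklington 0x684549de1 22 3
    (.mul (.small 137) (.mul (.small 7) (.mul (.small 3) (.small 2))))) (.small 3)) (.mul
    (.pocklington 0xd66fed9 23 17 (.mul (.mul (.small 13) (.small 2)) (.mul (.small 7) (.small 5))))
    (.pocklington 132751 2 3 (.small 59)))))) (.mul (.mul (.pocklington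
    0x14dfc406cbe67745232ea9f1af57f 3 7 (.mul (.pocklington 0x1a7667 3 3 (.mul (.small 23) (.mul
    (.small 3) (.small 2)))) (.mul (.pocklington 3463 2 1 (.small 577)) (.mul (.small 7) (.mul
    (.small 3) (.small 2)))))) (.mul (.mul (.pocklington 0x779b01bf 3 13 (.mul (.small 59) (.mul
    (.small 5) (.mul (.small 3) (.small 2))))) (.small 71)) (.mul (.pocklington 161071 3 3 (.mul
    (.small 7) (.mul (.small 5) (.small 2)))) (.pocklington 106681 17 5 (.mul (.small 7) (.mul
    (.small 5) (.small 2))))))) (.mul (.mul (.pocklington 0xef1e9409edb554a44f 3 1 (.pocklington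
    0x3d7bcb2bb999f13 2 1 (.pocklington 0x204fc5c172d1 2 5 (.mul (.pocklington 14879 2 3 (.small
    43)) (.small 23))))) (.pocklington 12391 13 5 (.mul (.small 5) (.mul (.small 3) (.small 2)))))
    (.mul (.pocklington 0x957220ca2d4d14acff 3 1 (.pocklington 0x2f5ea7f7922af 2 1 (.pocklington
    0x9bb8313399 2 3 (.mul (.small 967) (.small 137))))) (.pocklington 0x6673eb9 3 3 (.mul (.small
    59) (.mul (.small 5) (.small 2))))))))

/-- Data to exclude the small factors of `wagstaff 12391`. -/
def smallFactorData : List FactorFree :=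
  [ ⟨2 ^ 357, 1, 3, [-0x67325e370e9f96fae900968826ee2588271e40da7cd13b023709bad1a5e77b23724089ff56dce96cc9e5aa0b5fc9763319a7d11d462876d561bd9604fbcba489ed31fcca7fdc7c09c2c9773c926c277964d9f40a277848527cc77517c3b2883e00ea074e8a46c409dfb4bed82acdab4d2a49121e96b2ae7c4cfa0dc3146aff30721f1fe014b4582010f8d83b00f281340f89e073fe65749511567734909e868cad98352d63dc5da613bd276150ae78bf1c664885642bcd2c463cbaa12703e3e35d4d9c8e472a1b688481487e,
      0x391d05663c78905766eb26f610336d694ac2d6b5d70a3acc82dc2c847e8b5c90512b56d785d40f670af657e250bea0f8ef9949504462d50186827ada6ee885d4103f652ac560240753794cc45ce181ccf88bce66ca14ade14b5e09948bbd2a6110fc650d47eff8bcfac4b9390bb7eb04b50c0e29d13c9a0944daad555cb182d31d2486cd6b666b57f6753b77e881356e87c7a0bcc0648bb14af04c65ae7477a4a20978274ab1032895b62c41e074fbcba12178821b1ec0ed6496178b115b562a6721a5ae1a78e92b4a1b65b0b4ba51e5d85a455a008c0193e63d12d03c20aca9dac6cccabadf2361c3c6720ed79c157cf774fd3d45612f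d32b,
      0x262cef7ad90c7da375e6371c6ca241cd58e5e55093f75ed1800f41fd03db65a4842046160953407112e6885816d638061c1eaa5b28bef22fe56677d081cd5464f947ae16949dc7d099b05f047bc4d4a54ae4205c9f6f89b8adb218ba4fa61a5312241768412ddf39a36e799e2860ebe6231b03d4bc71f1bda7c4f1547eeadf81bcbe0faa4616ed621f377477ac3c16c3597863e73cfe9b33a5849a3adcbd3c1371415a1245702ed88283ebc3a03a4e2012505157ee483115363b016d4fc34b827e685b765862ccd6dbcd527689f05fac6369a513325a7b9d271c131dbf65fa8a8fd16635b4a985fe9051cba3c77a05992bbfd16ecf3e6ec2ad5971a30e0e38d0faf6f8553bff108b91f0eda8a4f99cfd6952ef6dcfe5802a3c1b3436910404f54e7aa5c283b,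
      0x691305540312c302aabf0f8c249e0af45e2444b399cfb44480f7fef79553bdbe66084eb63494935de361ae2621d24a63293ee90600bb30e5d1a0ef91f3abca8e8c0374291714285c4bf9da32e4c58f33dda90c12cd31ac24981ce24832413b96bc69c23725684eece537391c017eecedfc431286e00de538b75c1d9e7a983c79e5c64116a78b29a4a2c731bbee3eb5ade3f630ae94729856f10a0a35b476edee79ef9c0ef8aa79747b5e318e8c09da692b6a74591de126d092a8fdbf37b644a9245af37ca3fefe3c42cabbceabb0a5bff839818205144e6558607a8c197de232b0c21108524ef357e833aaa357d6e6c88dac41516093e6e3b3a78d9ef03a20a06dd04b9d86b9beb8a5305218c006beb6a15aaebee70e8be680f6d8daebf6cf2b20e9ca3ab683b99eeaea8c5f87db51496ab4d88b3f18d7480f5bf201fe03ac8de0bacbfc32b610432bdfe9ddc8a3dbd41a06,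
      -1]⟩,
    ⟨2 ^ 733, 2, 7, [-0x2d50e57337956f7916e2c486805c5da61675f7a4bf0c42ac6547d3370c0579b86780d7d9cbc34a46dcd43f97e7bbac2ae7162e3a57de88d9e24e272920018c2a47759,
      0x3af35ec5fdf4886c60559035514a5b9098a0d8f639925e7c15d7c8a08c0a525be4423bffe6cc33e9324836d3bce6f8a93accdf6d686525654d859be717916d83b1798c0fa3c06548c09d2d0590aa146816adf5038a159ab51f2bb7fc21c8d31ab9bbf8dedbb3fe0e1b869361f31ddaaa820f88f8eab11a1768825c666a942fceb3f4bf676d24828c81827d588aa7fe11ed8763529038d850350303aadda9,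
      -0xafb092459418c0c575845afb126146206f416af7c9d07a84c0247d25216dee4eabb71dc6960232b5ae2b9f2c53aea31a670ed8de2f0d9aaa29266d51bc83a60dc004165b77b8a6e776da77d924646d7b8ee1756b356749a1dc86997ac97a3ae04b2d5f718756c74fbfba74fce008bc70df79efd6ccde1d32d4d1c4ddd5c5fb402fd943ef0411fdb8cadd06d8e3690a1172efd2bdd31b4d318ee9cd29af92e9d9953287721fa7f63e21281dddb1452609278e7a710c7fb101b4775d5e76780beea5f2ecc6e379772542d17685983d0e10bad8047bea2f24ffe44a155c8b8671a9c3e676fb45e5678ba04c8fbb9080e894ab17ad97d8e24f14346,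
      -0x176d9b43529ead190ab7f16339b70ffcafcdc66087d082f8d2f017c65edf0be90316c346dca925ade7d900c6e415b45c073924051bdd75f34827605a28a74a39d90ea9a32cc163fd4f31fac8eae9f44ba86065e484153c4b16340f97b0b81c96b9b5eb03bee505ee00cdcc9f3d0629fb0120419714aa2b1da56e35163a56961c97305ca16fc5d122eea62e8f210e5c52aa358a6dc80b801bf08f8788d0327cf4ab07a2aca6cddfa027140603ea4768e8e9366f7f0fa5eb0098c5ae52d1e86fb0a12953aad9a4bf02fdb6a872ab99e33c43e6995aa80a6d89b5ce19854b4692c40d64a43b8c82cd77837967a8bf6a084d8703c71768b887a1c3b1040c2cb06ffbd4b6cdd8df002e74192c6030f301ad5c721212a32fe496f45c6d7bc9e170380450c26f57bcb2c429e375895453bf3be99ef0fa152106f17384eae9e6734e53f7b7d52fca608ad32d41da3e28a52a557d41eedbe6bf7,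
      -0x38c4e6a4ca36e13e0091a878253ef5f17255a423a1a091bab76ad071e3f9de89efea2e3d1a942176f3bda2452ed015cbc495ef5dc55c879e2e5bcede6d52ef1a05a6b0ef3c5c5203661fcf70d8637a5b9c97d42b431949f28be85968ee68b4f8e9ee2a122b9e9df26bc7de680a59d15c19521ed0e9bb3a6e7f4b72a80b0e129fa8144037f10b45cc77ea59376b33f7e6fefbdb0dfdaa1362af1cca44ca90fc7f64a07c82ed73986daf4a153cf41670d8dc507679be77a0bbd7e7e4026d6b20953f139ae902020edf6e7fa42a2cbae5b88dfe520f7f5b6c23033b47221e65aa31abdab984473bc314e3d869a46f9e2a64a9f0a14749978a934cc3caeac03c14ede2874c6308f759635251378038cdac4e47357ec044cda150342b715bb869e35dd1e170ae1a033ebac84169bee1ac907b506dba83b130446bd3aac42f4c3adcb7f7ed90709f3f2cd64ba2c20679f9f07e72e1822a01737ddfe4abc94c9eb5542fe4f7b24b9e14464769b4bf2d7f4f8d8313db50a423394e488e864ee47754914fee139f7e41fcc28a1d0076446dd4b3da3fa794cb0eba3ec67659314a9f6ff49e5d4f70123bcc7bcf42c309932e9be496e2,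
      0x823bb877b2e579a74dc827060090671d3e7790902b046b7f4888c70732c71dffb72aeb8c1a66b56c2fd5d40563e218fd78450817bdb9f34864a65a4ac6b133dc9d028c6fd08b204429a562a17d418e85d5d12d88d40857b95e15e3b9915d5450b02922a0a6e646465f3a965a31200e2b84c31fcd6e7b447037e4a738708e02cf96e8a5c9b586db9fb48b5a43750c11c1ebbee77b55f1cf919661db16a296415c92a0762240159f8cda44a305da99f478aac4c11582909d55a8c9cb67dc0ca9ba72f6a985f72a52573e2e4e949edfbd4c1b1064d8f1de82039b137a2a7ed7bae402aef51881ca1dbca914ec684506f1d04de86142487dc8ef8ef372769c2920799c29d2270e9f24404ddd958d9dc2e0ad668df94fe7322a0f25cd02d9bf6646c9f97dbd3a6f21a39edece91d90dd23c09f8c20f711de4a685b04d6aff2071b257bf3710e905e5ff021b9b4296a76b5f52c35f39d0e63630d5480b0967fd393aebf832d33ec6323b49645cf4984d00aca4f48d2d9e94f1d0b44114f4c4252a40ab55b3ceec6e5d5515f3b02900cc673965fbdf2741d13e62b897b055963813e5336c0e90c907651055fd7f1baded5e21df55f2b8fd092060812a8daef2ec95f5b7be3024263e8695b80b5ffae2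a8dec2d3116da90d94dfde8c04529ad5710cfaf2d8f0ed7b4ad6412e65cad4f6a4ebffaaf91e25f6d485e83671d4de2fe45cc4dbcdf1d8bb3d6cd6b808ad87f05,
      -0x87fbaf2b6e852f19de59510028d43bf20beb82eeee01579f9929c54f52bc88414cbd7b383aa97799a1c1e6ff3decd2b2cd7143d4e9cd0538c0d7d67545992756b17c49109aa550977b71700aad3d939092b4b5a17d762eb469c2d76ef762f69c90bb826a476b8a0fa18940a01010d93e1cbf550024fdb38c787d3817a58c213be1b3a99c5ee3fcb3c13ad45700c32e009edd5e9ea523546a50604fc127ad782ad68a94a88498fd4a75c8ed9c14af707c5a9835732cb77dfaad047d5743ada876bb715611192115674343ce6ecef633d096a6565e88fd164c2b275d8b394e24a34e6a189c94781311738ff18690f8c536ca5f85f775223860c55cdf40c18928a39d16c89c6617832b98d653109f78b4c6572fd037a925811593091dad4564841f855142f1ba0370657b105b3052512703c9569c7f0d859b6119bc9f464696e144c1c91110a65dabf9b9b7dc94da9ec43928d25b6d3afa01640a021b4ebcc8f8d16271411a0e5eca42aefb29a4c7e0e9936ba44cdf7527ba812de768ac6687f3162b9bf37d88cc9e2161a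210c6a4eae55998e7fd69c1164087d016fc47c8c6188d64db7a30550af857582b8d9d9fca5bed8d8d142c0bd8929889d784cfb01ea5d479e7520a2a010cb1ed0e8023cb1d3c8e8aaa3804cbf5e1e0bff2c4c7fd4a45b0f9cfbea343f92eca713b26cb587238f9daa46a222ed162f82045c790d3f7f6b5f3333e12e0abaa3ef3580aec07312b62384050a059580b98cb963abad2c70f15bc596a8248ad5cd11f01974634fb2c9a3ce6167e4ae65812b913497ea86089bc1f0926453e8facec047fb0fec7f51a95098088b783f2a6091d32fb0602739df25a7d315508170f22,
      -0x23cd95c096cbc9dd388948ffed68b68ca11ac40122b097854c34e7612922c7256979e7aa1d0b05d38dce1c39e856e9cd3164bde10d86946bd8d0bd058c2a91dda692c121ca2f9d9a603e5853bc0202b1cfececf41274bd0bec59fd3c2a72356b138286adafc46c0a00f31a4c5600024e22e6b59fee2367eab2049cf541929f4560f976f9719ad613d2a81cf693002e0f53219747f7edb219601f886a761f03fb4ed8a4950f2d90d1b91070b4b79adb6a7885325190f86732d400770ad8193d94eca7c3a01abf8d0ec2f341fe1c5dc48f9cafbe917a1779101c5829120c3be275c040226543b8d4417b96b8ea85ed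4997fac806c07355fd5a7874d8216429dd026367435518f97c5b9aba556f18fdb298a31f6a91f94fbf0f381aad6f5669c4e6c9bd2414dd0b60bbf39da613d773ed1ca4bdd74ca89981c165f1081020147a4eaada85ec13b7a91e05bc3b17ee631625dcc2df9004f87f7ef990fa9a38540d360b68474d7a33b6588b8e40490e99677d75c7a6dceeb639d24fa43cbdc1331c52c03294aa20c8f1d323e32bb89c9509032c67bf96a19267aa44dc39f88ac7f2c134d0df0a08a92e245694aadf3c3941c1ec3fcfeeb0188774ab70242f09fc3fb73beec08a8e09089de5c421e6f20662d4cb66b2cb6f6a5c0dac0f1f082455ed7ad7c43ed85cd8922b997680bf82d179ba5c0caa690af6cb8103e8343d6b6be9991359b60c9bb7dba91c7605328c96dc47c7a7797bf198621ed1a2b7e31e6f3977a5dde74920399b40d53d955753776b7dafb2732226cba8deed37f0a4d191c044c36e9746d4de69062063fe02b27ca88782af968088b68360f690aae0d5e525994d82e80e78c3c4df09e3b33024d30c7aaa3261014732cbda4de60488ec7138c97a12014bc241b381c95d27b27bec72e0b809e2785846b3d908f14d81138059dc9f47cd7f85821e3f9c1d3349bfa6a995c910e6455aebdf420cd4f5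ec4c08f03c518a948,
      -1,
      0]⟩,
    ⟨2 ^ 876, 3, 7, [-0x253d034b85471ee601a4e1509ddf45203866bda195044b5c7b5655d15aa69af6062f69a098f1c4b445dd06298ba5596c7bd08dcb539faf4acecd70da6b2ce769594b,
      -0x481e8832dac41046b3472f4251ecb01b6b92b88e42d4be9e085b1537204b1274801908e48b20269d36b9f7b6cc538a141748e63e66fdf68192986586f59781b94d930413a804c6178ed027a7b47f2fe2f8ed7be09c6e395f67e0386f570ee417ce2c7aaee49260f58c67ff940a4029642f93b766d53aba8133876a45eb2a69868dbd7673ea10e5ef9572efc554b8d1a15d15591856cbb918a06db4665743c8955b77ee004d7c52dc7040abd04a981c4,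
      0x271687f4391c15b427b7584c9d3ccb5fd0603bdd12b49a5f9c02854026850fb5e459f9e4d1a5e09dae1b4dd64d09b70d72067c03c7ba9d6247cc34373f58762b513dfa25e82d86029ea41ecd6a1e2933683d19fe1e302075f2dc7f7170edcd931f253682ca58ece80c5cf6b50bc9a484a2042abdad23d60c5a4c69f65c434107016f4109b7ae6e5a3987710a3833c4d84b8baaa4d44011a7eab821369cf82e55d09065324e1dd557ebeaf66edcfdb2f9312c2d09c5fa8de5bff57f0093144cb150243a5bd55bbac13bd20be25736aca806fbae11fe3800f45e33ced4ad0e3b08d834d25bd32bbc44ae96ae6531974e8ec780ac12de56bc17858778487282c0e34138d6c9557c92dc5dd05e9a67499305c090072aa68fc1fba9838e49e4,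
      -0x22c4f4a60bab601478b7c053f57b1ef68a85416646d1446ffc683dbbdeba6b923fea6c596b7306c4a1dd270057d881376d95deb74a2c1a172141bfc630514dbdf8c88be9efc1e20fcd2aca04cdb479453ffb829e94711b1395ba772ff84421a55c53dd21b9cd26cbad0f0cef0f56fb34fb4d75dc524f00d6a891cfe7339996e0466f9f03f7edddd342ab8ddb20082953dfcb3d1188b66ad91850a3133eba0c2cf9e10de2fdb19fc231a6021acb0bd9f00edcb79c4a0e2e41a6b16b58b17f56e50c07716bfebfa2aef18afb4cd68bd130452fa00f055aacd9c6700477e244b4ec2cf86f981db0479536eefc6337a17eafa32cbd824230b3fb0d2e9a3669ee1447c8f36fc7cb00d08534548be081bbbf8c857bd94c96b2b91b87fbb977592ead4a2e803a03f97b08c4e8a931d2dd23071161c13df2c8a46aa58c3c55359036e2cf0fee98dba051b7b64d50b4bde83744127b4866f9c1f5fd549baffbbd3b48d5152c3f1e62af3fff3516e3a9f1e2be47b09bd0d360529c77efc24421dd3c340f4546a9293717723a6c6d173,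
      -0x8c5f895f2c295fe29a5255a072c58cdc8a3ace5e5fd1dc353ca661c419d53806a9b4f74171f591ef5168db1ef85f285072b0736822e3d6938b233e72b1dfc055a1c8e52994bc545ccfaea2f8176d219a80e802fd67e9f187cc6e6d94d0dd42962bb1aa48668d6d97b08ff6f169758b3b4c25eddfe59c25f866e0efc97e60f21ba7a3e7c239dbe56a700aea7af51d440eb8082970cf4e81cda41b09414c70d32c0a2fded81b64dae68ff5e060b2261e89eda4b1c6cff21eb00f3da495748dd69c53d9a369d9f32314ea66e6d8e0b93f2e4043ee81fc927aae0f423ae38a43420a1eacc9be7d4882e6abc6376c45c005d5897ebab6088f29c10a930853388533020fe724537a3f355f770be9940f7c706b7db3d94680ca091a5ad286823af8067e26669303396f4b6ef3ecf22e05fe99efe14240c1d8c2c52be66041c4eb03c7721694dae7d620263797a65d8e8220c09f99e6bc79f5fed5efe6598af58d35bd7e84369d5e94b6e56f23dcaa07dbd7529dcdd04c77f38fdf0db52116c76f50e6cbec2193251c417a0b25f7737dcf80beead03ea7f6e01308c0a13126f19f5317003e54ec69d0e5ca0a3eecc1eb65971f5287d6052495b26bec1703d8a614eda1dcaebb3153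4368dd70b5d1a687b8ae830e3d83b7576360bd84dd7b0f82266c034f451e09cae0d058572499e8c95ca5459af3eebd1bd82e56fe,
      -0x6fb5e867587696207057ed628edf2ffcdf4325239558c3d000eaf9e39124d0c138d6ed2d877e571a9308de7fe0c51421cc4960161c4893983b4488bf66e5e3195ee68cab80b0aa682cf88e5a612e0141e856c5b5b0d50235cbb077e2da4c3577627b761da5de443adda39da001c97d51656f15a28a87705e62c9bd988c49e861137fe1be1b538efdd20aa3b65c77863004dc87a300b9b0412241f4a5f84c6b7bbf9474fbbf31c04e1522bf6d9afb04d92bef75fb501e6825240ab8d74b2fa4daefa25f5937f4f6d3845c437551fc6f912fb6d1735a4c492324ca4b6d2fad42c783af2010de823a305721b18f96b2af0e8d672f45fdb18cab7e9107a9ea8391d0fc053997fdb572aca06eb5cd48a917420609b4daa3a12243d89d2e486438cdcfc9553dd455ebb8f406c963d88a45c248e6e2cb72e30b9aa72f640758bbffcb99b20b1162a30226077a6edd3c3d55aedf470c2ce0e9aec87923fb59c5d7cfa277979d16e0741e7c17245203b04e213c64969698983ff2e549e6df0817f3c15bdad45b42d815dfdf2407d5ddadd0bf396a305c162245b484b6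dfbbb2b663f5cff06806c2f97fd2700da3297fc6f175d9ccf55612ceecff556ce546a7b26733075b50cce4d288b49090f1fb5bd18676bd0eae1d76953805ff579c28a9cd9bc53a89363679561ad5783b4d3d991a55d05183cea20fe154fe49385a57b35261a7f7868d2bbb383d4b3156029c30f88efffb343073506a1e990c974f22ee9421d242be9fbcfbf94e9ad3dc65f3194b49ac5359bc3d8da79e5523ee450a629c4661ee2ead46f42c72b95ba1dc0dcc48db720d2b3c8567b605c89a092f6d5409ed9c649f54c310b3eef,
      0x1cf87236b52c472a1df028a2b8ef9cb387c1a84c0c8bf7f4143d4692db93922855813c2eb5c5fe38e99713395097410a07ae43db6168cdbbaa4ad1de9964165095e9037e839adaa48fd6192812eecff327c121203a6bf0eee103270b1a93f83b75655842c5762be3cebed485b0e8966661daf7aa8a30ac72c005af3cfa306a9a01bfb349b5d8c5fb90f0a6434a92789861fdfde3a28b36847270aaee98314a91865ea029bc25c19717bb9970745e0306273189787fa4a36e83c6bf3cff62b87ad8167466c58b5ccfd96fd9cbfeab1294d869981f659d9258391355a657a340619499bb2d2847eea3088d54ec83013ebe89c02b1632aad76f07786603803ae9c53b42e5dd42aa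d4147d756ee8c3d96c65661b4d95ff0495a1bdc884a8a0ca27776347964eaed94adc6bd00678077dfbb4fdc281a020c0d7bd8cb178c958b73eb248690c45afd265a7c0632990bb9014ae96ae4a3bd7cfcb69a312ea2012692082059d2170a01eaf00dbba470a492333cdbd483eaa8a3ea07e332656faaa71e07963c4acb4d7c5a9bee62f8d40dc561d06edc5a9ecd9e7280fecac17cc7f37c8ceded72f5fdf398647de6cdd2d4275d4004a70e17da41e2f4457d6c6ab82b41b2494bf0d4eaed73e98caf82ace919022d48bc4488de5aa877acbade1e034b27879c8bafd1b61da2444cd33f3d1582b8c3cd151903246ca360f4d7d8a87a54f63bf4d58bd7f25efda48dee33434a9d19bf2e5466e902bd7196cf47c018b08b1f58e8eb4b17603be381718d13252d22c3c1d2be13cc4175857c22619606d4258e2c4407755e9323ef0d772c221c9a8e711fbc2b18b484731309134e88a9b316f00ea29418672c57605d7c283f7da25fb5d5928540ef2a79aa49bdded6666fab915261e441b4978fe283c563faf9d738b3078268a7b9f43617dff933f7c3c20b8b981190dec5b1e586c1af7d4f853b045fc3a9092bab8d64d1e3fbd8112bd5b7aa1b7b9dd2cf56e87036c2cfc549d6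58ec65b3bcb73,
      0x3e7b7028852240d065d934708ff4adf8da719590e1d1e3b34d80434efdf95048e4b52fe037a8f7eb6742998d3ceafad40ec308ebd774351832f54546ef256964fd3ecfd14d4d9a8c78e8b0e45d8b26f46d6b281f6509d680216a1c9385e88c817db1432d657f977ed2fbdde696015bab83064a3631775d9498d1731cfcc233735122dcbc1408a036dad84e75172d100d359faf0f7f8f9a75877a9bd53f6a4e0c94cb3801392fccfc9e497bcc5e74512fe58201d237b50021b610524bf4e1ddcbebdf656cb354e6922eb1f5cb5a20bb2ad81aeeb1317934605c13d84f77835f98122053497c170957a845cbc1d3fbb6b60b827af195e524ab5c50cefc350cdbdbf04f0e0b4c5316d7801a5d1147dac9e43bb119304b80c5f7d920f46e0b717b945a5b06b7c1e11115faa1bda7f648d5d76b172b2502b6c0b0af451199d80c9528e93dea4459e4d4b55f957e02bbba5bd85b38f34ed66787b2e6e32740f9a39854ac7958bc9d0634c2250d7c570d1eb158871c06a16986c543ef51038d85c02e2d1cf96dd7e40ee8503821f68b9435b9fad015f4bdf441f5cd13104c62ff93ed5bd2b0fb0f9b36712f3f6407eccbff9e317ed4812142aef9609005631cb59700726ef2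6f37255ab6b85e07cb88ce43b4423ab5c1684f46175ddf0221a09421485c7aa7c0d3345d6ae6be8998f28270dba66a5ff2a896680f5e909c2aa54591f0bacfaefa81b0a5c7995f6bf7b76a87d9ef62f72895013e474fe5e12407569f342a0087cd84249f3bbcd35b29ab1f602ede00a8be3c9b39bc9b110b481fe5a58217d8ab864a67c64d60ec84bcd6513866b5fc745ae026310b446fca3b4423bcd6f8a7d0bc10ff338535128926b529d7101c9fcb421ee531fe509137a9a0f89e21022520716a46de251f63651d74ac5e90921111373447d586bd37707fcb2bed028ad629cf014eb153ecb83e9d8c058fb4fffead234d088bb42eca876542086c024ff52ecee3d412fe8c19e5b4858c7e092b939f8400b6a0cf5b1e3276627f482b9398b089296554120f3839e1079016d1db3b55860411cb2ac0752be8a0709e1777c29bdd749dfa0d21f8e656f7674453e5da76e334ad2859a31291858391772d3ecb8cfca5a007a5f480111680f70912cce75e19e44927773afce8c95a9e9d887ee,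
      -0x6df3a5f0f8e8a113b1edebbfa72e3ee77f27c264b74df5086cf4da9f32110e306117d2107cb0b90062a6294688727b72b83da6e990bd813743f17f97d1cea31844aaebd22edc651cad30c971129768a45d7cbae013014d6a2971c038c338f89d35ef3a01591e609d116837f0e5abc58d1ef526834b2bcca0b77b65de18e533400fab751e383266c1a5f2b43689e2c6d09523f95bca49b5616dd0eb7b417bd6712f3e6d7f396553e21bd4bfc48028253b2dc0283b00bb98b288b2eae38bc66d94330215e0c1d10ef565bc0c8b0a6510ed2069a7410cf69564f344e5010f57268b70d102087f61df023651ae023948141b75d4fca825c46a951e7f9d3a287b1ac86e87fe6dd0342b8181371a1da59b251b2cb3019ceea07f7b16f8b69e7d5c88ad897632f651740de06ece5ed03376c8d3ddf2445ad7cd34596369cff95d018fdeca2d423d8a6454cb7d7322a20e58fc7321811fd544dafe2c4ae217027bfc242dd41491ec55f525e58f67694e1e72db1192f8d1e868c5ea7afa75d6458fea9d1232b191e18042af16eee570a013a7f72eddb5a6da5b35f01586da03e106cfacc71bb3654f5b051be19233267b54c5b221603999c3d663f441530d3cf231eba753af98131ebf5e2621c2cfd0b4fc180ce40bdfdb9d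1612254898d9828ebb7a3b5307ffc15e0e991a81c3020537fb19dd80302c533020ba40a9514595abd2352f06615c692275aca8dbbf0f117580f495fcfcb547cc798629d1182688256f5ffa1f56e4e196b8e033471b53105f48fa4b934031db17dd84e50da6b9fe94ef431497cce631254d8427ad1905d0d02dda13f8d168a4fe987a0a237fac3d80068c3a814a3cace9d49172363188d7400e79e6d03f3cdfc74445bd1276262d72b35a809e67c97b3c89d885621fc1604b23f18f0fcbb51044ceed2d2f86653479130cdb59af1edd2692acee27c71586dec5521018c524827416e445a655fc22ef65ae5178944b1b8f6e35bfdc341b057e091a4a27254a376a03d55c9ff8b35bae08e9dc5cd2b28650f125884441d26807febda2217509b4890cbad4337b2c7bda652e18c7b4a971e6e346dc2c49a874317306c5f825f65ea04bb66e5273059329fa403195a9f2f34fa1bcf6be591eb629b576857bcb9396b36fa3bcb7a7212dfec881a8bb395d5f1b8808ad2b631e6b0abc7541fdb9b3475a3f833f3aea82212c954d53bc3ad00c24db569fe3c5cdda98b7a384fdc5d4314b8dfaceaff9f3378b6b02b1fee38a074d858e100c6cec27830c2a85346f3383a78ba82746ce1904a833d979c1fc7438ae79efe9c0ce33f267ee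de,
      0x53e7b5a73546109fd3e6c013fd6b6c386aa9a47044e5c4b1b3b975e2feb2170f3fb818d070796113a8394e089e6e1638343aada8ba492f04bdbcbf17ad88d5dd19ff8fd18ed45763e2986dd1aa30df00cb440ad9b6d2f6eb7485783cd132d4ce8bccf5deb7c503d95a1e14dcaf94f0fad9185f9da351dced33beffdd464ac40d307df0326a48c2bd41c6695e058783b5d05aba2ea4fa65c3d5c2e399fe7a6070956289377102f6b1e371ac367af3eddbf3af740a2e3c24262f10e002de8fe00d2d8ff152b042def6492b59d41571db56db0e4558de0ac701ec7f6e49ac7e7ee9e5904e0cf725998f697b3e8009e7fa135213d9409fc7951d75b056f0c4ee03c5a3bd85076b01d721d12bf95888c25dd0eecbcd4153e5e99fcdfe1f952d7c7d695671dac60c794d615d91b240b683327eb9280db64b75f8044d2bb1aaf47c99dca042566aaaa5b27a9cb53f9c3639c0e5b621cc0f09efd4d0aa58e2e04b4854ed89297a8f39622d039177c38a96282b4cfeaf4bcad13f823159aa9da31cd942c936c0c744568d09b24bc2ff9d46a69da4245ef6030772f6c0b60d2923ccacd3ba100d76fa3e1634a88ce0cb3a23bdc446bb09246b916d86283c6d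34e3e09a7672306b101370a45dba3a104a1ab5037305096e6376f9be64e2c3be5e6b893b8d8db19fc782a1f0b5189a3560e5ab0c3a302fa3a71a82d4b16cac889500d83381aa25d959862326363a513f681da34d6f572a0a6b95bc3180ddb2ba18463cfea139002834c12873f7250ebaa242fb055a53e274c796cebbfc2d9f430687137f8b54dea6f09de0f11c3c113649f1996606ed1116baeb44deafa3738df2c27ea752558e409ec3cb629fedd57a4f6a90be845d222c2f0b4905010b73853eb99fdde89daef8234704f50a18fd5ff4139d2b034ddcfeb8bcf4872f5a4684a4934a15713760cc471a85141d2e844aeec050eaec87d8487fde7c2909d840ae6d9b3be41da4810f0e54e024f4039a803a988f669cb54190822ece92b9f42dd395fb72d61447eea7a953d3d082eba1bd4148c1a512a53dcf80a1c4d4b630db003e3e13c743cf50756627d74d11934f5269557a2870e45d76eda45c620b777b10762876c59577f5f21fcd993e8543a57a14587117cce5eb1a6860a06565e3215235bf27463661b41418a15b7646cd57d01c4257d58bb4c46b827598f60d1ef390a24c9317b90ddf945eb195a6b6f1eddbea568de628f1e13896a6a354851d222d30bb4b9a9afe597347342459354779c251fc3ff760a1d6c5ad051351df09deaf16e12e8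5b7f23f62fdf01751a89ca4fa9e85194c3f9dfd55ea8cd3e0da67744ab24d6cdaade8a6c06f25f3263bf1204f819856d53d325c6eea76d1ed386d191de9f0984642b519e899cc4674ab3f3b9a085e59bcc9027d1cefe2831a424959de8c42822d9d8e80e725a7eb80779c7412a8455cb25b0808ed0fa8f5673a48aab147d,
      -1,
      -1,
      0]⟩ ]

/-- The multiplier for `sumCheck_wagstaff`, with which the linear congruence has small coefficients. -/
def congruenceMultiplier : ℤ :=
  0x735a303d3663710db108ed9e1043da52d7b283342883e55577760c4c61088f3384f3be231c6bf21a2a0fd1a2496012f065b7c94f206152fb6c0d658392764627c17ed8f77d9b92554c61a103c9a856be2b352a0d8b4d727c9d21ae9148c6b0f4c7d27e91e2d880c053517c4714aee96a633231ba3d582719cd2e273d96fc044a69f8f44ff6c5b00bea24f7a71830ece6d546f72df7183c39ebf140840457eeba44c348d36f869a2e207437e4966c3f748c48bb031151d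

/-- `wagstaff 12391` as a norm from `ℤ[√-2]`. -/
theorem wagstaff_eq_norm :
    ((wagstaff 12391 : ℕ) : ℤ) = ((1 - 2 ^ 6196) / 3) ^ 2 + 2 * ((2 ^ 6195 + 1) / 3) ^ 2 := by
  decide +kernel

theorem gcd_wagstaff : Int.gcd (wagstaff 12391 : ℕ) ((2 ^ 6195 + 1) / 3) = 1 := by
  decide +kernel

theorem check_orderCertificate : orderCertificate.check = true := by
  decide +kernel

theorem check_mul_cofactorCertificate :
    (orderCertificate.mul cofactorCertificate).check = true := by
  decide +kernel

theorem modOneCheck_wagstaff :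
    (orderCertificate.mul cofactorCertificate).modOneCheck (wagstaff 12391) 3 = true := by
  rw [← forced_eq (fun N => PrimeProduct.modOneCheck N _ _)]
  decide +kernel

/-- The ordinate is a square root of -3: as N is 3 modulo 4, the exponent is (N + 1) / 4, which is
below 2 ^ 2 ^ 14. The multiple 2 e is 6 B, where (A - 1) ^ 2 + 2 B ^ 2 = 6 B ^ 2. -/
theorem pointCheck_wagstaff : JacobianCoords.pointCheck (wagstaff 12391)
    (powMod (wagstaff 12391) (wagstaff 12391 - 3) ((wagstaff 12391 + 1) / 4) 14) (2 ^ 6195 + 1)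
    orderCertificate = true := by
  have h : forced (fun N => forced (fun y => forced (fun e =>
      JacobianCoords.pointCheck N y e orderCertificate) (2 ^ 6195 + 1))
        (powMod N (N - 3) ((N + 1) / 4) 14)) (wagstaff 12391) = true := by
    decide +kernel
  simpa only [forced_eq] using h

/-- As A - 1 = -2 B, the two coefficients of the congruence are opposite modulo G, so a single
multiplier makes both small. -/
theorem sumCheck_wagstaff : sumCheck orderCertificate.value cofactorCertificate.value
    ((1 - 2 ^ 6196) / 3) ((2 ^ 6195 + 1) / 3) (2 ^ 2883) congruenceMultiplier = true := by
  have h : forcedInt (fun M => forcedInt (fun G => forcedInt (fun A => forcedInt (fun B =>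
      forcedInt (fun Y => sumCheck M G A B Y congruenceMultiplier) (2 ^ 2883)) ((2 ^ 6195 + 1) / 3))
        ((1 - 2 ^ 6196) / 3)) cofactorCertificate.value) orderCertificate.value = true := by
    decide +kernel
  simpa only [forcedInt_eq] using h

theorem checkAll_wagstaff :
    forced (fun F => forced (fun R => FactorFree.checkAll (wagstaff 12391) F R (fun T =>
      Nat.blt 0 T && Nat.blt (3 * (R / F / F / T)) F &&
        FactorFree.cubicCheck (R % F : ℕ) (R / F % F : ℕ) (R / F / F : ℕ) 2 &&
        decide (48 * (orderCertificate.value : ℤ) ^ 2 ≤ T * F ∧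
          4 * ((wagstaff 12391 : ℕ) : ℤ) ≤ (orderCertificate.value * 2 ^ 2883) ^ 2 * (T * F)))
        1 smallFactorData) ((wagstaff 12391 - 1) / F))
      (orderCertificate.mul cofactorCertificate).value = true := by
  decide +kernel

set_option exponentiation.threshold 4000 in
theorem prime_wagstaff : (wagstaff 12391).Prime :=
  Nat.Prime.of_norm (by decide +kernel) (by decide +kernel) wagstaff_eq_norm gcd_wagstaff
    check_mul_cofactorCertificate modOneCheck_wagstaff check_orderCertificate (by decide +kernel)
    (by decide +kernel) (by rw [PrimeProduct.value]; push_cast; rfl) (by decide +kernel)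
    (by decide +kernel) (by decide +kernel) pointCheck_wagstaff (by simp [smallFactorData])
    checkAll_wagstaff (by positivity) sumCheck_wagstaff

set_option exponentiation.threshold 4000 in
theorem length_digits_wagstaff : (Nat.digits 10 (wagstaff 12391)).length = 3730 := by
  have h1 : 10 ^ 3729 ≤ wagstaff 12391 := by decide +kernel
  have h2 : wagstaff 12391 < 10 ^ 3730 := by decide +kernel
  rw [Nat.length_digits 10 _ (by norm_num) (by omega), Nat.log_eq_of_pow_le_of_lt_pow h1 h2]

theorem mainTheorem3 :
    Nat.Prime (wagstaff 12391) ∧ (Nat.digits 10 (wagstaff 12391)).length = 3730 :=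
  ⟨prime_wagstaff, length_digits_wagstaff⟩
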